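/- **Setting.** Let $M$ be an oriented three-manifold with an ideal triangulation $\mathcal T=\{\mathcal T_1,\dots,\mathcal T_N\}$, i.e. $M$ is obtained from $N$ oriented tetrahedra with vertices removed by glueing their faces in pairs by orientation-reversing maps. (If the boundary of $M$ is a union of tori this is the usual setting; no assumption on the boundary is needed.) Let $\mathcal B$ be $\mathbb R$, $\mathbb C=\mathbb R+\mathbb R i$ or the algebra $\mathbb R+\mathbb R\tau$ of pseudo-complex numbers, $\tau^2=1$, with conjugation $z\mapsto\bar z$ and $|z|^2=z\bar z\in\mathbb R$. Let $\mathbb X$ be the space of real lines spanned by Hermitian $2\times2$ matrices over $\mathcal B$ of positive determinant, so $\mathbb X=\mathbb H^2,\mathbb H^3,\mathrm{AdS}^3$ respectively. The group $\mathrm{PGL}^+(2,\mathcal B)$ of matrices $A$ with $|\det A|^2>0$, up to scalars, acts on it by $X\mapsto AXA^*$. Four points $[v_a]\in\mathbb P^1\mathcal B$ determine an ideal tetrahedron if the matrices $\sum_a p_a v_av_a^*$ ($0\le p_a<1$, $\sum_a p_a=1$) represent points of $\mathbb X$. Its shape parameter at the edge $v_1v_2$ is the image $z\in\mathcal B$ of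 $[v_4]$ under the isometry that takes $[v_1],[v_2],[v_3]$ to $\infty,0,1$; one has $|z|^2,|1-z|^2>0$. The parameters at the edges are $z$ (edges $12$, $34$), $\frac1{1-z}$ (edges $13$, $24$), $\frac{z-1}z$ (edges $14$, $23$). The dihedral angle at an edge with parameter $w$ is $\arg w$ over $\mathbb C$ (used when $\operatorname{Im}w>0$). Over $\mathbb R$ and $\mathbb R+\mathbb R\tau$ it is $\pi$ or $0$ according as the real part of $w$ is negative or positive. *Thurston's equations* for $(z_j)\in\mathcal B^N$, with $|z_j|^2,|1-z_j|^2>0$, ask that around every edge of $\mathcal T$ the product of the parameters is $1$ and the total dihedral angle is $2\pi$. The set of their real solutions is the real deformation variety $\mathscr D_{\mathbb R}\subset\mathbb R^N$. A *triangulated $\mathbb X$-structure* on $(M,\mathcal T)$ is a realization of the $\mathcal T_j$ as ideal tetrahedra of $\mathbb X$, glued along their faces by elements of $\mathrm{PGL}^+(2,\mathcal B)$ whose composition around every edge is the identity, with total dihedral angle $2\pi$ around every edge. It is a *transversely hyperbolic foliation* if $\mathcal B=\mathbb R$. It is a *hyperbolic*, resp. *AdS*, *structure* if $\mathcal B=\mathbb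 C$, resp. $\mathcal B=\mathbb R+\mathbb R\tau$, and all the tetrahedra are positively oriented. Such structures $\mathscr S_t$, $t>0$, *collapse* to a foliation $\mathcal F$ as $t\to0$ if, for suitable choices of the developing maps (which are defined up to isometry), the developed ideal vertices of every tetrahedron of the universal cover converge in $\mathbb P^1\mathcal B$ to those for $\mathcal F$ (hence the developing maps converge), and the holonomies converge in $\mathrm{PGL}^+(2,\mathcal B)$ to that of $\mathcal F$. A point of $\mathscr D_{\mathbb R}$ is *smooth* if $\mathscr D_{\mathbb R}$ is an embedded real-analytic submanifold of $\mathbb R^N$ near it (for instance, if it is a nonsingular point of the variety). A *tangent vector* is the velocity at the point of a curve in $\mathscr D_{\mathbb R}$. **Proposition 5.1.** Let $(z_j)\in\mathbb R^N$ be a solution of Thurston's equations at which $\mathscr D_{\mathbb R}$ is smooth, and let $(v_j)\in\mathbb R^N$ be a tangent vector to $\mathscr D_{\mathbb R}$ at $(z_j)$ with $v_j>0$ for all $j$. Then there is a transversely hyperbolic foliation $\mathcal F$ on $(M,\mathcal T)$ with shape parameters $(z_j)$, and there are hyperbolic structures $\mathscr H_t$ and AdS structures $\mathscr A_t$ on $(M,\mathcal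 T)$, defined for $t>0$, such that $\mathscr H_t$ and $\mathscr A_t$ collapse to $\mathcal F$ (to every foliation with shape parameters $(z_j)$) as $t\to0$. More precisely, there are $C^\infty$ paths $\zeta:\mathbb R\to\mathbb C^N$ and $\xi:\mathbb R\to(\mathbb R+\mathbb R\tau)^N$ with $\zeta_j(0)=\xi_j(0)=z_j$, $\zeta_j'(0)=iv_j$ and $\xi_j'(0)=\tau v_j$ such that, for all $t>0$, $\zeta(t)$ and $\xi(t)$ solve Thurston's equations over $\mathbb C$ and $\mathbb R+\mathbb R\tau$, have all imaginary parts positive, and are the shape parameters of $\mathscr H_t$ and $\mathscr A_t$. -/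

import Mathlib

open Filter Topology
open scoped ContDiff

noncomputable section

/-! ## Oriented ideal triangulations -/

/-- An oriented topological ideal triangulation with `N` tetrahedra.  Each tetrahedron has
vertices `0, 1, 2, 3` (removed) and faces `0, 1, 2, 3`, face `f` being opposite to vertex `f`.
Face `f` of tetrahedron `j` is glued to face `perm j f f` of tetrahedron `nbr j f`, the vertex
`a ≠ f` of the face going to the vertex `perm j f a`.  The glueings reverse the orientations of
the faces, so that the orientations of the tetrahedra (given by the order of the vertices)
fit together. -/
structure IdealTriangulation (N : ℕ) where
  nbr : Fin N → Fin 4 → Fin N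
  perm : Fin N → Fin 4 → Equiv.Perm (Fin 4)
  nbr_nbr : ∀ j f, nbr (nbr j f) (perm j f f) = j
  perm_perm : ∀ j f, perm (nbr j f) (perm j f f) = (perm j f)⁻¹
  sign_perm : ∀ j f, Equiv.Perm.sign (perm j f) = -1
  no_fixed_face : ∀ j f, ¬ (nbr j f = j ∧ perm j f f = f)

namespace IdealTriangulation

variable {N : ℕ} (T : IdealTriangulation N)

/-- A pair `(j, π)`, with `π` an even permutation, stands for the tetrahedron `j` with its
vertices listed in the positive order `π 0, π 1, π 2, π 3`, seen from its oriented edge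
`π 0 → π 1`.  Turning once about that edge, one leaves the tetrahedron through the face opposite
to `π 2` and gets to the next tetrahedron around the edge, again seen from that edge. -/
def turn (x : Fin N × Equiv.Perm (Fin 4)) : Fin N × Equiv.Perm (Fin 4) :=
  (T.nbr x.1 (x.2 2), T.perm x.1 (x.2 2) * x.2 * Equiv.swap 2 3)

/-- The `i`-th tetrahedron met when turning about the edge given by `x`. -/
def around (x : Fin N × Equiv.Perm (Fin 4)) (i : ℕ) : Fin N × Equiv.Perm (Fin 4) :=
  T.turn^[i] x

/-- The number of tetrahedra (with multiplicity) around the edge given by `x`. -/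
def valence (x : Fin N × Equiv.Perm (Fin 4)) : ℕ :=
  Function.minimalPeriod T.turn x

/-- The tetrahedron where one arrives from `j` by crossing faces successively.  The
tetrahedra of the universal cover are such paths of faces, up to homotopy. -/
def walk : Fin N → List (Fin 4) → Fin N
  | j, [] => j
  | j, f :: γ => walk (T.nbr j f) γ

end IdealTriangulation

/-! ## The algebras of shape parameters

The algebra `B` is one of `ℝ`, `ℂ` and the pseudo-complex numbers, with its conjugation `star`. -/

/-- The pseudo-complex numbers `ℝ + ℝτ`, `τ² = 1`; conjugation is `star (a + bτ) = a - bτ`. -/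
abbrev PseudoComplex : Type := QuadraticAlgebra ℝ 1 0

instance : TopologicalSpace PseudoComplex :=
  TopologicalSpace.induced (fun z => (z.re, z.im)) inferInstance

section Algebra

variable {B : Type} [CommRing B] [StarRing B] [Algebra ℝ B]

/-- `z` is space-like: its square-norm `|z|² = z z̄` is a positive real number. -/
def Spacelike (z : B) : Prop := ∃ r : ℝ, 0 < r ∧ z * star z = algebraMap ℝ B r

/-- Two vectors of `B²` define the same point of the projective line `ℙ¹B`. -/
def SamePoint (v w : Fin 2 → B) : Prop := ∃ c : Bˣ, w = (c : B) • v

/-- The Hermitian matrix `v v*` of rank one that corresponds to the point `[v]` of the ideal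
boundary `ℙ¹B`. -/
def boundaryMatrix (v : Fin 2 → B) : Matrix (Fin 2) (Fin 2) B := Matrix.vecMulVec v (star v)

/-- The standard three-simplex with its vertices removed. -/
def standardIdealSimplex : Set (Fin 4 → ℝ) := {p | (∀ a, 0 ≤ p a ∧ p a < 1) ∧ ∑ a, p a = 1}

/-- The (homogeneous form of the) map from the standard ideal simplex to the real projective
space of the real vector space of Hermitian `2 × 2` matrices. -/
def simplexMap (v : Fin 4 → Fin 2 → B) (p : Fin 4 → ℝ) : Matrix (Fin 2) (Fin 2) B :=
  ∑ a, p a • boundaryMatrix (v a)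

/-- The ideal points `[v 0], …, [v 3]` determine an ideal tetrahedron: the simplex that they
span lies in the model space `𝕏`, which is the set of (lines spanned by) Hermitian matrices `X`
with `⟨X, X⟩ = - det X < 0`.  (Replacing `v` by `τ v` changes the sign of `v v*` over the
pseudo-complex numbers, so all choices of signs are covered by the choice of the vectors.) -/
def IsIdealTetrahedron (v : Fin 4 → Fin 2 → B) : Prop :=
  ∀ p ∈ standardIdealSimplex, ∃ r : ℝ, 0 < r ∧ (simplexMap v p).det = algebraMap ℝ B r

/-- The coordinates `x₁, x₂, x₃, x₄` of the Hermitian matrix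
`!![x₁ + x₂, x₃ - x₄ κ; x₃ + x₄ κ, x₁ - x₂]`, where `re` and `im` are the coordinates of
`B = ℝ + ℝκ`. -/
def hermitianCoords (re im : B → ℝ) (X : Matrix (Fin 2) (Fin 2) B) : Fin 4 → ℝ :=
  ![(re (X 0 0) + re (X 1 1)) / 2, (re (X 0 0) - re (X 1 1)) / 2, re (X 0 1), - im (X 0 1)]

/-- The simplex map preserves the orientations, that of projective space being given by the
coordinates `x₁, x₂, x₃, x₄`. -/
def PositivelyOriented (re im : B → ℝ) (v : Fin 4 → Fin 2 → B) : Prop :=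
  0 < (Matrix.of fun a => hermitianCoords re im (boundaryMatrix (v a))).det

/-- `z` is the shape parameter (the cross ratio) of four ideal points with `[v 0], [v 1], [v 2]`
determining an ideal triangle: the isometry that takes `[v 0], [v 1], [v 2]` to `∞, 0, 1` takes
`[v 3]` to `z`. -/
def HasShape (v : Fin 4 → Fin 2 → B) (z : B) : Prop :=
  ∃ A : Matrix (Fin 2) (Fin 2) B, Spacelike A.det ∧
    SamePoint (A.mulVec (v 0)) ![1, 0] ∧ SamePoint (A.mulVec (v 1)) ![0, 1] ∧
    SamePoint (A.mulVec (v 2)) ![1, 1] ∧ SamePoint (A.mulVec (v 3)) ![z, 1]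

/-- The shape parameter of the edge `ab` of a tetrahedron with shape parameter `z` at the
edge `01`: it is `z` at `01` and `23`, `1 / (1 - z)` at `02` and `13`, and `(z - 1) / z` at `03`
and `12`. -/
def edgeParameter (z : B) (a b : Fin 4) : B :=
  if ({a, b} : Finset (Fin 4)) = {0, 1} ∨ ({a, b} : Finset (Fin 4)) = {2, 3} then z
  else if ({a, b} : Finset (Fin 4)) = {0, 2} ∨ ({a, b} : Finset (Fin 4)) = {1, 3} then
    Ring.inverse (1 - z)
  else (z - 1) * Ring.inverse z

end Algebra

/-- The dihedral angle of a collapsed tetrahedron at an edge with real shape parameter `x`. -/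
def realAngle (x : ℝ) : ℝ := if x < 0 then Real.pi else 0

/-- The dihedral angle at an edge with space-like pseudo-complex shape parameter `w`: writing
`w = ± r (cosh φ + τ sinh φ)` with `r > 0`, it is the discrete rotational part of the similarity
`w`, which is `0` for the sign `+` and `π` for the sign `-`. -/
def pseudoAngle (w : PseudoComplex) : ℝ := if w.re < 0 then Real.pi else 0

namespace IdealTriangulation

variable {N : ℕ} (T : IdealTriangulation N)

section Algebra

variable {B : Type} [CommRing B] [StarRing B] [Algebra ℝ B]

/-- The solutions of Thurston's equations over `B`.  The parameters are parameters of ideal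
tetrahedra, the product of the parameters around every edge is one, and the total dihedral angle
around every edge is `2π`.  Here `angle` gives the dihedral angle at an edge in terms of its shape
parameter; it is `realAngle`, `pseudoAngle`, or `Complex.arg` (the last for positively oriented
tetrahedra). -/
def thurstonSolutions (angle : B → ℝ) : Set (Fin N → B) :=
  {z | (∀ j, Spacelike (z j) ∧ Spacelike (1 - z j)) ∧
    ∀ (j : Fin N) (π : Equiv.Perm (Fin 4)), Equiv.Perm.sign π = 1 →
      (∏ i ∈ Finset.range (T.valence (j, π)),
        edgeParameter (z (T.around (j, π) i).1)
          ((T.around (j, π) i).2 0) ((T.around (j, π) i).2 1)) = 1 ∧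
      (∑ i ∈ Finset.range (T.valence (j, π)),
        angle (edgeParameter (z (T.around (j, π) i).1)
          ((T.around (j, π) i).2 0) ((T.around (j, π) i).2 1))) = 2 * Real.pi}

/-- The real deformation variety. -/
def realDeformationVariety : Set (Fin N → ℝ) := T.thurstonSolutions realAngle

variable (B) in
/-- A realization of the tetrahedra of `T` as ideal tetrahedra of the model space `𝕏` of `B`,
glued along their faces by isometries so that the structure extends over the edges, up to the
condition on the total dihedral angles.  The tetrahedron `j` has ideal vertices `[vertex j a]`;
the isometry `[glue j f]` in `PGL⁺(2, B)` puts the tetrahedron `nbr j f` next to the tetrahedron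
`j` along its face `f`.  The composition of the glueing isometries around every edge is the
identity of `PGL⁺(2, B)`. -/
structure Realization where
  vertex : Fin N → Fin 4 → Fin 2 → B
  glue : Fin N → Fin 4 → Matrix (Fin 2) (Fin 2) B
  ideal : ∀ j, IsIdealTetrahedron (vertex j)
  isometry : ∀ j f, Spacelike (glue j f).det
  face : ∀ j f a, a ≠ f →
    SamePoint ((glue j f).mulVec (vertex (T.nbr j f) (T.perm j f a))) (vertex j a)
  edge : ∀ (j : Fin N) (π : Equiv.Perm (Fin 4)), Equiv.Perm.sign π = 1 →
    ∃ c : Bˣ, ((List.range (T.valence (j, π))).map fun i =>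
      glue (T.around (j, π) i).1 ((T.around (j, π) i).2 2)).prod = (c : B) • 1

namespace Realization

variable {T} (S : T.Realization B)

/-- The tetrahedra of the realization have shape parameters `z j`. -/
def HasShapes (z : Fin N → B) : Prop := ∀ j, HasShape (S.vertex j) (z j)

/-- The total dihedral angle around every edge is `2π`, where `angle` gives the dihedral angle at
an edge in terms of its shape parameter. -/
def TotalAngle (angle : B → ℝ) : Prop :=
  ∀ (j : Fin N) (π : Equiv.Perm (Fin 4)), Equiv.Perm.sign π = 1 →
    ∃ w : ℕ → B,
      (∀ i, HasShape (fun a => S.vertex (T.around (j, π) i).1 ((T.around (j, π) i).2 a)) (w i)) ∧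
      ∑ i ∈ Finset.range (T.valence (j, π)), angle (w i) = 2 * Real.pi

/-- The isometry that places the last tetrahedron of a path of tetrahedra when these are
developed one after the other, starting with the tetrahedron `j`.  When the path ends at
`j`, this is the holonomy of the loop. -/
def develop : Fin N → List (Fin 4) → Matrix (Fin 2) (Fin 2) B
  | _, [] => 1
  | j, f :: γ => S.glue j f * develop (T.nbr j f) γ

/-- The ideal vertices of the last tetrahedron of a path, developed from the tetrahedron `j`.
On the tetrahedron of the universal cover given by the path, the developing map
is (the class of) `simplexMap (S.developedVertex j γ)`. -/
def developedVertex (j : Fin N) (γ : List (Fin 4)) (a : Fin 4) : Fin 2 → B :=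
  (S.develop j γ).mulVec (S.vertex (T.walk j γ) a)

end Realization

end Algebra

/-- A triangulated hyperbolic structure: positively oriented ideal tetrahedra of `ℍ³`. -/
structure HyperbolicStructure extends T.Realization ℂ where
  oriented : ∀ j, PositivelyOriented Complex.re Complex.im (vertex j)
  angle : toRealization.TotalAngle Complex.arg

/-- A triangulated anti de Sitter structure: positively oriented ideal tetrahedra of `AdS³`. -/
structure AdSStructure extends T.Realization PseudoComplex where
  oriented : ∀ j, PositivelyOriented QuadraticAlgebra.re QuadraticAlgebra.im (vertex j)
  angle : toRealization.TotalAngle pseudoAngle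

/-- A triangulated transversely hyperbolic foliation: collapsed ideal tetrahedra, that is, ideal
tetrahedra of `ℍ²`. -/
structure TransverselyHyperbolicFoliation extends T.Realization ℝ where
  angle : toRealization.TotalAngle realAngle

variable {T}

/-- The structures `S t`, `t > 0`, collapse to the foliation `F` as `t → 0`: for a suitable choice
of the developing maps (they are defined up to composition with an isometry `g t j`, where `j` is
the tetrahedron from which one develops), the ideal vertices of every developed tetrahedron
converge in `ℙ¹B` to those of the developed collapsed tetrahedron of `F`, so that the developing
maps converge to the developing map of `F`, and the holonomies converge in `PGL⁺(2, B)` to that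
of `F`. -/
def CollapsesTo {B : Type} [CommRing B] [StarRing B] [Algebra ℝ B] [TopologicalSpace B]
    (S : Set.Ioi (0 : ℝ) → T.Realization B) (F : T.TransverselyHyperbolicFoliation) : Prop :=
  ∃ g : Set.Ioi (0 : ℝ) → Fin N → Matrix (Fin 2) (Fin 2) B,
    (∀ t j, Spacelike (g t j).det) ∧
    (∀ j γ a, ∃ c : Set.Ioi (0 : ℝ) → Bˣ,
      Tendsto (fun t => (c t : B) • (g t j).mulVec ((S t).developedVertex j γ a))
        (comap Subtype.val (𝓝 0))
        (𝓝 fun k => algebraMap ℝ B (F.developedVertex j γ a k))) ∧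
    (∀ j γ, T.walk j γ = j → ∃ c : Set.Ioi (0 : ℝ) → Bˣ,
      Tendsto (fun t => (c t : B) • (g t j * (S t).develop j γ * (g t j)⁻¹))
        (comap Subtype.val (𝓝 0))
        (𝓝 ((F.develop j γ).map (algebraMap ℝ B))))

end IdealTriangulation

/-! ## Smooth points and tangent vectors -/

section Smooth

variable {E : Type*} [NormedAddCommGroup E] [NormedSpace ℝ E]

/-- The (real algebraic or analytic) set `D` is smooth at its point `z`: near `z` it is an embedded
real-analytic submanifold.  That is, it has a local parametrization `φ` at `z`, an analytic
immersion that takes the neighbourhoods of `0` to the neighbourhoods of `z` in `D`. -/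
def IsSmoothPoint (D : Set E) (z : E) : Prop :=
  ∃ (d : ℕ) (φ : (Fin d → ℝ) → E), AnalyticAt ℝ φ 0 ∧ φ 0 = z ∧
    Function.Injective (fderiv ℝ φ 0) ∧ map φ (𝓝 0) = 𝓝[D] z

/-- `v` is tangent to `D` at `z`: it is the velocity at `z` of a curve in `D`. -/
def IsTangentVector (D : Set E) (z v : E) : Prop :=
  ∃ γ : ℝ → E, γ 0 = z ∧ HasDerivAt γ v 0 ∧ ∀ᶠ s in 𝓝 0, γ s ∈ D

end Smooth

end

/-!
Over any of the three algebras, a solution of Thurston's equations gives a realization with all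
tetrahedra in standard position `∞, 0, 1, z j`; it depends continuously on the parameters, so
convergence of the parameters implies convergence of the developed tetrahedra and of the holonomies.
It remains to deform the real solution `z` into the two algebras.  Near a smooth point the tangent
vector `v` is the velocity of an analytic curve `c` of real solutions.  Its complexification solves
the edge equations by the identity theorem, and `c (i s)` has velocity `i v`; its total angles are
multiples of `2π` near the total angles `2π` of `z`.  Similarly `c (τ s)` makes sense: under
`ℝ + ℝτ ≅ ℝ × ℝ`, `a + bτ ↦ (a + b, a - b)`, it is the pair `(c s, c (-s))` of real solutions.
-/

noncomputable section

/-! ## Projective transformations -/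

section Projective

variable {B : Type} [CommRing B]

namespace SamePoint

variable {u v w : Fin 2 → B}

theorem symm (h : SamePoint v w) : SamePoint w v := by
  obtain ⟨c, rfl⟩ := h
  exact ⟨c⁻¹, by simp [smul_smul]⟩

theorem trans (h : SamePoint u v) (h' : SamePoint v w) : SamePoint u w := by
  obtain ⟨c, rfl⟩ := h
  obtain ⟨d, rfl⟩ := h'
  exact ⟨d * c, by simp [smul_smul]⟩

theorem of_eq_smul {c : B} (hc : IsUnit c) (h : v = c • w) : SamePoint v w :=
  symm ⟨hc.unit, h⟩

theorem mulVec (h : SamePoint v w) (A : Matrix (Fin 2) (Fin 2) B) :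
    SamePoint (A.mulVec v) (A.mulVec w) := by
  obtain ⟨c, rfl⟩ := h
  exact ⟨c, Matrix.mulVec_smul A _ v⟩

theorem adjugate_mulVec {A : Matrix (Fin 2) (Fin 2) B} (hA : IsUnit A.det)
    (h : SamePoint (A.mulVec v) w) : SamePoint (A.adjugate.mulVec w) v := by
  refine (h.symm.mulVec A.adjugate).trans (of_eq_smul hA ?_)
  rw [Matrix.mulVec_mulVec, Matrix.adjugate_mul, Matrix.smul_mulVec, Matrix.one_mulVec]

end SamePoint

/-- The determinant of two vectors. It is a unit when they define points of `ℙ¹B` in general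
position. -/
def wedge (v w : Fin 2 → B) : B := v 0 * w 1 - v 1 * w 0

theorem wedge_self (v : Fin 2 → B) : wedge v v = 0 := by
  simp only [wedge]; ring

theorem wedge_smul_smul (c d : B) (v w : Fin 2 → B) :
    wedge (c • v) (d • w) = c * d * wedge v w := by
  simp only [wedge, Pi.smul_apply, smul_eq_mul]; ring

theorem wedge_mulVec (A : Matrix (Fin 2) (Fin 2) B) (v w : Fin 2 → B) :
    wedge (A.mulVec v) (A.mulVec w) = A.det * wedge v w := by
  simp only [wedge, Matrix.mulVec, dotProduct, Fin.sum_univ_two, Matrix.det_fin_two]; ring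

theorem matrix_eq_of_mulVec_eq {A A' : Matrix (Fin 2) (Fin 2) B} {p q : Fin 2 → B}
    (hpq : IsUnit (wedge p q)) (hp : A.mulVec p = A'.mulVec p) (hq : A.mulVec q = A'.mulVec q) :
    A = A' := by
  ext i k
  have hpi := congrFun hp i
  have hqi := congrFun hq i
  simp only [Matrix.mulVec, dotProduct, Fin.sum_univ_two] at hpi hqi
  refine hpq.mul_left_cancel ?_
  rw [wedge]
  match k with
  | 0 => linear_combination q 1 * hpi - p 1 * hqi
  | 1 => linear_combination p 0 * hqi - q 0 * hpi

/-- Points of `ℙ¹B` in general position: any two of the vectors form a basis of `B²`. -/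
def GeneralPosition {ι : Type*} (v : ι → Fin 2 → B) : Prop :=
  Pairwise fun a b => IsUnit (wedge (v a) (v b))

namespace GeneralPosition

variable {ι κ : Type*} {v : ι → Fin 2 → B}

theorem comp (hv : GeneralPosition v) {f : κ → ι} (hf : Function.Injective f) :
    GeneralPosition fun a => v (f a) :=
  fun _ _ hab => hv (hf.ne hab)

theorem of_samePoint_mulVec {w : ι → Fin 2 → B} (hw : GeneralPosition w)
    {A : Matrix (Fin 2) (Fin 2) B} (h : ∀ a, SamePoint (A.mulVec (v a)) (w a)) :
    GeneralPosition v := by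
  intro a b hab
  obtain ⟨c, hc⟩ := h a
  obtain ⟨d, hd⟩ := h b
  have hu : IsUnit (wedge (w a) (w b)) := hw hab
  rw [hc, hd, wedge_smul_smul, wedge_mulVec] at hu
  exact isUnit_of_mul_isUnit_right (isUnit_of_mul_isUnit_right hu)

end GeneralPosition

/-- A projective transformation is determined by the images of three points: comparing the
determinants of pairs shows that the three factors of proportionality coincide. -/
theorem eq_smul_of_samePoint {A A' : Matrix (Fin 2) (Fin 2) B} (hA' : IsUnit A'.det)
    {v : Fin 3 → Fin 2 → B} (hv : GeneralPosition v)
    (h : ∀ a, SamePoint (A'.mulVec (v a)) (A.mulVec (v a))) : ∃ c : Bˣ, A = (c : B) • A' := by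
  choose c hc using h
  have hdet : ∀ a b, a ≠ b → A.det = c a * c b * A'.det := by
    intro a b hab
    refine (hv hab).mul_right_cancel ?_
    rw [← wedge_mulVec, hc, hc, wedge_smul_smul, wedge_mulVec, ← mul_assoc]
  have hc01 : c 0 = c 1 := by
    refine Units.ext (((c 2).isUnit.mul hA').mul_right_cancel ?_)
    rw [← mul_assoc, ← mul_assoc, ← hdet 0 2 (by decide), ← hdet 1 2 (by decide)]
  refine ⟨c 0, matrix_eq_of_mulVec_eq (hv (show (0 : Fin 3) ≠ 1 by decide)) ?_ ?_⟩
  · rw [hc, Matrix.smul_mulVec]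
  · rw [hc, Matrix.smul_mulVec, hc01]

/-- The vertices `∞, 0, 1, z` of a tetrahedron in standard position. -/
def standardVertex (z : B) : Fin 4 → Fin 2 → B := ![![1, 0], ![0, 1], ![1, 1], ![z, 1]]

/-- The projective transformation that takes `[v 0], [v 1], [v 2]` to `∞, 0, 1`. -/
def normalizer (v : Fin 3 → Fin 2 → B) : Matrix (Fin 2) (Fin 2) B :=
  !![wedge (v 2) (v 0) * v 1 1, -(wedge (v 2) (v 0) * v 1 0);
    wedge (v 2) (v 1) * v 0 1, -(wedge (v 2) (v 1) * v 0 0)]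

theorem normalizer_mulVec (v : Fin 3 → Fin 2 → B) (x : Fin 2 → B) :
    (normalizer v).mulVec x =
      ![wedge (v 2) (v 0) * wedge x (v 1), wedge (v 2) (v 1) * wedge x (v 0)] := by
  ext k
  fin_cases k <;>
    simp only [normalizer, wedge, Matrix.mulVec, dotProduct, Fin.sum_univ_two, Fin.zero_eta,
      Fin.mk_one, Matrix.of_apply, Matrix.cons_val] <;> ring

theorem det_normalizer (v : Fin 3 → Fin 2 → B) :
    (normalizer v).det = wedge (v 2) (v 0) * wedge (v 2) (v 1) * wedge (v 1) (v 0) := by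
  simp only [normalizer, Matrix.det_fin_two_of, wedge]; ring

namespace GeneralPosition

variable {v : Fin 3 → Fin 2 → B}

theorem isUnit_det_normalizer (hv : GeneralPosition v) : IsUnit (normalizer v).det := by
  rw [det_normalizer]
  exact ((hv (by decide)).mul (hv (by decide))).mul (hv (by decide))

theorem samePoint_normalizer (hv : GeneralPosition v) (z : B) (a : Fin 3) :
    SamePoint ((normalizer v).mulVec (v a)) (standardVertex z a.castSucc) := by
  rw [normalizer_mulVec]
  have hu {a b c d : Fin 3} (hab : a ≠ b) (hcd : c ≠ d) :
      IsUnit (wedge (v a) (v b) * wedge (v c) (v d)) := (hv hab).mul (hv hcd)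
  match a with
  | 0 =>
    refine .of_eq_smul (hu (show 2 ≠ 0 by decide) (show 0 ≠ 1 by decide)) ?_
    ext k; fin_cases k <;> simp [standardVertex, wedge_self]
  | 1 =>
    refine .of_eq_smul (hu (show 2 ≠ 1 by decide) (show 1 ≠ 0 by decide)) ?_
    ext k; fin_cases k <;> simp [standardVertex, wedge_self]
  | 2 =>
    refine .of_eq_smul (hu (show 2 ≠ 0 by decide) (show 2 ≠ 1 by decide)) ?_
    ext k; fin_cases k <;> simp [standardVertex, mul_comm]

end GeneralPosition

/-- The projective transformation that takes `[v a]` to `[w a]`. -/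
def triangleMap (v w : Fin 3 → Fin 2 → B) : Matrix (Fin 2) (Fin 2) B :=
  (normalizer w).adjugate * normalizer v

theorem GeneralPosition.samePoint_triangleMap {v w : Fin 3 → Fin 2 → B} (hv : GeneralPosition v)
    (hw : GeneralPosition w) (a : Fin 3) : SamePoint ((triangleMap v w).mulVec (v a)) (w a) := by
  rw [triangleMap, ← Matrix.mulVec_mulVec]
  exact ((hv.samePoint_normalizer 0 a).mulVec _).trans
    ((hw.samePoint_normalizer 0 a).adjugate_mulVec hw.isUnit_det_normalizer)

/-- `w` is the cross ratio of four points, that is, the image of `[v 3]` under the transformation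
that takes `[v 0], [v 1], [v 2]` to `∞, 0, 1`. Both sides are multiplied by the denominators, so
that nothing is inverted. -/
def IsCrossRatio (v : Fin 4 → Fin 2 → B) (w : B) : Prop :=
  w * (wedge (v 2) (v 1) * wedge (v 3) (v 0)) = wedge (v 2) (v 0) * wedge (v 3) (v 1)

namespace IsCrossRatio

variable {v : Fin 4 → Fin 2 → B} {w : B}

theorem isUnit (hw : IsCrossRatio v w) (hv : GeneralPosition v) : IsUnit w := by
  refine isUnit_of_mul_isUnit_left (y := wedge (v 2) (v 1) * wedge (v 3) (v 0)) ?_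
  rw [hw]
  exact (hv (by decide)).mul (hv (by decide))

theorem samePoint_normalizer (hw : IsCrossRatio v w) (hv : GeneralPosition v) :
    SamePoint ((normalizer fun a => v a.castSucc).mulVec (v 3)) ![w, 1] := by
  have hu : IsUnit (wedge (v 2) (v 1) * wedge (v 3) (v 0)) :=
    (hv (by decide)).mul (hv (by decide))
  refine .of_eq_smul hu ?_
  rw [normalizer_mulVec]
  ext k
  fin_cases k
  · simpa [mul_comm w] using hw.symm
  · simp

theorem samePoint_diagonal_mulVec (hw : IsCrossRatio v w) (hv : GeneralPosition v) (z : B)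
    (a : Fin 3) : SamePoint ((Matrix.diagonal ![w, 1]).mulVec (standardVertex z a.castSucc))
      ((normalizer fun a => v a.castSucc).mulVec (v (Fin.succAbove 2 a))) := by
  have hinit := (hv.comp (Fin.castSucc_injective 3)).samePoint_normalizer z
  match a with
  | 0 =>
    refine .trans (.of_eq_smul (hw.isUnit hv) ?_) (hinit 0).symm
    ext k; fin_cases k <;> simp [Matrix.mulVec_diagonal, standardVertex]
  | 1 =>
    refine .trans (.of_eq_smul isUnit_one ?_) (hinit 1).symm
    ext k; fin_cases k <;> simp [Matrix.mulVec_diagonal, standardVertex]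
  | 2 =>
    refine .trans (.of_eq_smul isUnit_one ?_) (hw.samePoint_normalizer hv).symm
    ext k; fin_cases k <;> simp [Matrix.mulVec_diagonal, standardVertex]

/-- In the coordinate that puts an edge at `∞, 0`, crossing the face opposite to the third vertex
multiplies by the shape parameter. -/
theorem exists_normalizer_mul_eq_smul (hw : IsCrossRatio v w) (hv : GeneralPosition v)
    {v' : Fin 3 → Fin 2 → B} (hv' : GeneralPosition v') {A : Matrix (Fin 2) (Fin 2) B}
    (hA : ∀ a, SamePoint (A.mulVec (v' a)) (v (Fin.succAbove 2 a))) :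
    ∃ c : Bˣ, (normalizer fun a => v a.castSucc) * A =
      (c : B) • (Matrix.diagonal ![w, 1] * normalizer v') := by
  refine eq_smul_of_samePoint ?_ hv' fun a => ?_
  · rw [Matrix.det_mul, Matrix.det_diagonal]
    simpa using (hw.isUnit hv).mul hv'.isUnit_det_normalizer
  · rw [← Matrix.mulVec_mulVec, ← Matrix.mulVec_mulVec]
    exact ((hv'.samePoint_normalizer 0 a).mulVec _).trans
      ((hw.samePoint_diagonal_mulVec hv 0 a).trans ((hA a).mulVec _).symm)

end IsCrossRatio

end Projective

/-! ## Space-like numbers and ideal tetrahedra -/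

section Spacelike

variable {B : Type} [CommRing B] [StarRing B] [Algebra ℝ B]

namespace Spacelike

variable {z w : B}

theorem one : Spacelike (1 : B) := ⟨1, one_pos, by simp⟩

theorem mul (hz : Spacelike z) (hw : Spacelike w) : Spacelike (z * w) := by
  obtain ⟨r, hr, h⟩ := hz
  obtain ⟨s, hs, h'⟩ := hw
  refine ⟨r * s, mul_pos hr hs, ?_⟩
  rw [map_mul, ← h, ← h', star_mul]; ring

theorem neg (hz : Spacelike z) : Spacelike (-z) := by
  obtain ⟨r, hr, h⟩ := hz
  exact ⟨r, hr, by simpa using h⟩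

theorem sub_comm (h : Spacelike (z - w)) : Spacelike (w - z) := neg_sub z w ▸ h.neg

theorem isUnit (hz : Spacelike z) : IsUnit z := by
  obtain ⟨r, hr, h⟩ := hz
  have hzz : IsUnit (z * star z) := h ▸ hr.ne'.isUnit.map (algebraMap ℝ B)
  exact isUnit_of_mul_isUnit_left hzz

theorem of_mul_eq_one (hz : Spacelike z) (h : z * w = 1) : Spacelike w := by
  obtain ⟨r, hr, hzr⟩ := hz
  refine ⟨r⁻¹, inv_pos.2 hr, ?_⟩
  have hw : w * star w * algebraMap ℝ B r = 1 := by
    rw [← hzr, mul_mul_mul_comm, mul_comm w, h, mul_comm (star w), ← star_mul', h, star_one,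
      one_mul]
  have hr' : algebraMap ℝ B r * algebraMap ℝ B r⁻¹ = 1 := by
    rw [← map_mul, mul_inv_cancel₀ hr.ne', map_one]
  rw [← mul_one (w * star w), ← hr', ← mul_assoc, hw, one_mul]

theorem ringInverse (hz : Spacelike z) : Spacelike (Ring.inverse z) :=
  hz.of_mul_eq_one (Ring.mul_inverse_cancel z hz.isUnit)

end Spacelike

theorem spacelike_edgeParameter {z : B} (hz : Spacelike z ∧ Spacelike (1 - z)) (a b : Fin 4) :
    Spacelike (edgeParameter z a b) := by
  unfold edgeParameter
  split_ifs
  exacts [hz.1, hz.2.ringInverse, hz.2.sub_comm.mul hz.1.ringInverse]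

/-- The vertices `[v a]` span space-like edges, hence an ideal tetrahedron. -/
def SpacelikeEdges {ι : Type*} (v : ι → Fin 2 → B) : Prop :=
  Pairwise fun a b => Spacelike (wedge (v a) (v b))

theorem det_simplexMap (v : Fin 4 → Fin 2 → B) (p : Fin 4 → ℝ) :
    (simplexMap v p).det = ∑ x : Fin 4 × Fin 4 with x.1 < x.2,
      (p x.1 * p x.2) • (wedge (v x.1) (v x.2) * star (wedge (v x.1) (v x.2))) := by
  have hentry : ∀ i k, simplexMap v p i k =
      ∑ a, algebraMap ℝ B (p a) * (v a i * star (v a k)) := by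
    intro i k
    simp only [simplexMap, boundaryMatrix, Matrix.sum_apply, Matrix.smul_apply,
      Matrix.vecMulVec_apply, Pi.star_apply]
    exact Finset.sum_congr rfl fun a _ => Algebra.smul_def _ _
  simp [Finset.sum_filter, Fintype.sum_prod_type, Fin.sum_univ_four, Matrix.det_fin_two, hentry,
    wedge, Algebra.smul_def]
  ring

theorem exists_lt_pos_of_mem_standardIdealSimplex {p : Fin 4 → ℝ} (hp : p ∈ standardIdealSimplex) :
    ∃ a b, a < b ∧ 0 < p a ∧ 0 < p b := by
  obtain ⟨hp01, hsum⟩ := hp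
  obtain ⟨a, -, ha⟩ : ∃ a ∈ Finset.univ, 0 < p a :=
    Finset.exists_lt_of_sum_lt (by simp [hsum])
  obtain ⟨b, hb, hpb⟩ : ∃ b ∈ Finset.univ.erase a, 0 < p b := by
    refine Finset.exists_lt_of_sum_lt ?_
    have := Finset.add_sum_erase Finset.univ p (Finset.mem_univ a)
    have := (hp01 a).2
    simp only [Finset.sum_const_zero]
    linarith
  rcases (Finset.ne_of_mem_erase hb).lt_or_gt with h | h
  exacts [⟨b, a, h, hpb, ha⟩, ⟨a, b, h, ha, hpb⟩]

namespace SpacelikeEdges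

theorem comp {ι κ : Type*} {v : ι → Fin 2 → B} (hv : SpacelikeEdges v) {f : κ → ι}
    (hf : Function.Injective f) : SpacelikeEdges fun a => v (f a) :=
  fun _ _ hab => hv (hf.ne hab)

theorem generalPosition {ι : Type*} {v : ι → Fin 2 → B} (hv : SpacelikeEdges v) :
    GeneralPosition v :=
  fun _ _ hab => (hv hab).isUnit

theorem isIdealTetrahedron {v : Fin 4 → Fin 2 → B} (hv : SpacelikeEdges v) :
    IsIdealTetrahedron v := by
  intro p hp
  have hv' : ∀ a b, a ≠ b → ∃ r : ℝ, 0 < r ∧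
      wedge (v a) (v b) * star (wedge (v a) (v b)) = algebraMap ℝ B r := fun a b hab => hv hab
  choose! r hr hvr using hv'
  have hterm : ∀ a b, a < b → 0 ≤ p a * p b * r a b := fun a b hab =>
    mul_nonneg (mul_nonneg (hp.1 a).1 (hp.1 b).1) (hr a b hab.ne).le
  refine ⟨∑ x : Fin 4 × Fin 4 with x.1 < x.2, p x.1 * p x.2 * r x.1 x.2, ?_, ?_⟩
  · obtain ⟨a, b, hab, ha, hb⟩ := exists_lt_pos_of_mem_standardIdealSimplex hp
    refine Finset.sum_pos' (fun x hx => hterm _ _ (Finset.mem_filter.1 hx).2)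
      ⟨(a, b), by simpa using hab, mul_pos (mul_pos ha hb) (hr a b hab.ne)⟩
  · rw [det_simplexMap, map_sum]
    refine Finset.sum_congr rfl fun x hx => ?_
    rw [hvr _ _ (Finset.mem_filter.1 hx).2.ne, Algebra.smul_def, map_mul _ _ (r _ _)]

theorem spacelike_det_normalizer {v : Fin 3 → Fin 2 → B} (hv : SpacelikeEdges v) :
    Spacelike (normalizer v).det := by
  rw [det_normalizer]
  exact ((hv (by decide)).mul (hv (by decide))).mul (hv (by decide))

theorem spacelike_det_triangleMap {v w : Fin 3 → Fin 2 → B} (hv : SpacelikeEdges v)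
    (hw : SpacelikeEdges w) : Spacelike (triangleMap v w).det := by
  rw [triangleMap, Matrix.det_mul, Matrix.det_adjugate]
  simpa using hw.spacelike_det_normalizer.mul hv.spacelike_det_normalizer

theorem hasShape {v : Fin 4 → Fin 2 → B} {w : B} (hv : SpacelikeEdges v)
    (hw : IsCrossRatio v w) : HasShape v w := by
  have hinit := hv.comp (Fin.castSucc_injective 3)
  have hN := hinit.generalPosition.samePoint_normalizer 0
  exact ⟨_, hinit.spacelike_det_normalizer, hN 0, hN 1, hN 2,
    hw.samePoint_normalizer hv.generalPosition⟩

end SpacelikeEdges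

end Spacelike

/-! ## Tetrahedra in standard position -/

section Standard

variable {B : Type} [CommRing B]

theorem even_perm_values {π : Equiv.Perm (Fin 4)} (hπ : Equiv.Perm.sign π = 1) :
    (π 0, π 1, π 2, π 3) ∈ ([(0, 1, 2, 3), (1, 0, 3, 2), (2, 3, 0, 1), (3, 2, 1, 0),
      (0, 2, 3, 1), (2, 0, 1, 3), (3, 1, 0, 2), (1, 3, 2, 0),
      (0, 3, 1, 2), (3, 0, 2, 1), (1, 2, 0, 3), (2, 1, 3, 0)] :
        List (Fin 4 × Fin 4 × Fin 4 × Fin 4)) := by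
  revert π; decide

theorem isCrossRatio_edgeParameter {z : B} (hz : IsUnit z) (hz' : IsUnit (1 - z))
    {π : Equiv.Perm (Fin 4)} (hπ : Equiv.Perm.sign π = 1) :
    IsCrossRatio (fun a => standardVertex z (π a)) (edgeParameter z (π 0) (π 1)) := by
  have hinv := Ring.inverse_mul_cancel z hz
  have hinv' := Ring.inverse_mul_cancel (1 - z) hz'
  have hπ4 := even_perm_values hπ
  simp only [IsCrossRatio]
  generalize π 0 = a, π 1 = b, π 2 = c, π 3 = d at hπ4
  simp only [List.mem_cons, List.not_mem_nil, or_false, Prod.mk.injEq] at hπ4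
  rcases hπ4 with h | h | h | h | h | h | h | h | h | h | h | h <;>
    obtain ⟨rfl, rfl, rfl, rfl⟩ := h <;>
    simp +decide only [edgeParameter, if_true, if_false, wedge, standardVertex, Matrix.cons_val] <;>
    first
      | ring1
      | linear_combination hinv'
      | linear_combination -hinv'
      | linear_combination (1 - z) * hinv
      | linear_combination (z - 1) * hinv

theorem positivelyOriented_standardVertex [StarRing B] {re im : B → ℝ} {z : B} (h0 : re 0 = 0)
    (h1 : re 1 = 1) (h0' : im 0 = 0) (h1' : im 1 = 0) (hz : 0 < im z) :
    PositivelyOriented re im (standardVertex z) := by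
  rw [PositivelyOriented, Matrix.det_succ_row_zero]
  simp [Fin.sum_univ_four, Matrix.det_fin_three, hermitianCoords, boundaryMatrix,
    Matrix.vecMulVec_apply, standardVertex, Fin.succAbove, h0, h1, h0', h1']
  linarith

variable [StarRing B] [Algebra ℝ B] {z : B}

theorem spacelikeEdges_standardVertex (hz : Spacelike z ∧ Spacelike (1 - z)) :
    SpacelikeEdges (standardVertex z) := by
  have h1 := Spacelike.one (B := B)
  intro a b hab
  fin_cases a <;> fin_cases b <;>
    simp [wedge, standardVertex, h1, h1.neg, hz.1, hz.1.neg, hz.2, hz.2.sub_comm] at hab ⊢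

theorem hasShape_standardVertex_perm (hz : Spacelike z ∧ Spacelike (1 - z))
    {π : Equiv.Perm (Fin 4)} (hπ : Equiv.Perm.sign π = 1) :
    HasShape (fun a => standardVertex z (π a)) (edgeParameter z (π 0) (π 1)) :=
  ((spacelikeEdges_standardVertex hz).comp π.injective).hasShape
    (isCrossRatio_edgeParameter hz.1.isUnit hz.2.isUnit hπ)

theorem hasShape_standardVertex (hz : Spacelike z ∧ Spacelike (1 - z)) :
    HasShape (standardVertex z) z := by
  simpa [edgeParameter] using hasShape_standardVertex_perm hz (π := 1) (map_one _)

theorem HasShape.exists_samePoint_standardVertex {v : Fin 4 → Fin 2 → B} (h : HasShape v z) :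
    ∃ A : Matrix (Fin 2) (Fin 2) B, Spacelike A.det ∧
      ∀ a, SamePoint (A.mulVec (v a)) (standardVertex z a) := by
  obtain ⟨A, hA, h0, h1, h2, h3⟩ := h
  refine ⟨A, hA, fun a => ?_⟩
  fin_cases a
  exacts [h0, h1, h2, h3]

end Standard

/-! ## Realization of the solutions of Thurston's equations -/

theorem diagonal_one_one {R : Type*} [Zero R] [One R] :
    Matrix.diagonal ![(1 : R), 1] = 1 := by
  ext i k; fin_cases i <;> fin_cases k <;> rfl

namespace IdealTriangulation

section Turn

variable {N : ℕ} (T : IdealTriangulation N)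

theorem turn_snd_castSucc (x : Fin N × Equiv.Perm (Fin 4)) (a : Fin 3) :
    (T.turn x).2 a.castSucc = T.perm x.1 (x.2 2) (x.2 (Fin.succAbove 2 a)) := by
  have h : ∀ a : Fin 3, Equiv.swap (2 : Fin 4) 3 a.castSucc = Fin.succAbove 2 a := by decide
  rw [← h]
  rfl

theorem sign_turn (x : Fin N × Equiv.Perm (Fin 4)) :
    Equiv.Perm.sign (T.turn x).2 = Equiv.Perm.sign x.2 := by
  simp [turn, T.sign_perm]

theorem around_succ (x : Fin N × Equiv.Perm (Fin 4)) (i : ℕ) :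
    T.around x (i + 1) = T.turn (T.around x i) :=
  Function.iterate_succ_apply' _ _ _

theorem around_valence (x : Fin N × Equiv.Perm (Fin 4)) : T.around x (T.valence x) = x :=
  Function.iterate_minimalPeriod

theorem sign_around (x : Fin N × Equiv.Perm (Fin 4)) (i : ℕ) :
    Equiv.Perm.sign (T.around x i).2 = Equiv.Perm.sign x.2 := by
  induction i with
  | zero => rfl
  | succ i ih => rw [around_succ, sign_turn, ih]

end Turn

section Edge

variable {N : ℕ} (T : IdealTriangulation N) {B : Type} [CommRing B]

/-- The product of the parameters of the edges that are glued to the edge given by `x`. -/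
def edgeProduct (z : Fin N → B) (x : Fin N × Equiv.Perm (Fin 4)) : B :=
  ∏ i ∈ Finset.range (T.valence x),
    edgeParameter (z (T.around x i).1) ((T.around x i).2 0) ((T.around x i).2 1)

/-- The total dihedral angle around the edge given by `x`, where `angle` gives the dihedral angle
at an edge in terms of its shape parameter. -/
def edgeAngle (angle : B → ℝ) (z : Fin N → B) (x : Fin N × Equiv.Perm (Fin 4)) : ℝ :=
  ∑ i ∈ Finset.range (T.valence x),
    angle (edgeParameter (z (T.around x i).1) ((T.around x i).2 0) ((T.around x i).2 1))

theorem mem_thurstonSolutions_iff [StarRing B] [Algebra ℝ B] {angle : B → ℝ} {z : Fin N → B} :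
    z ∈ T.thurstonSolutions angle ↔ (∀ j, Spacelike (z j) ∧ Spacelike (1 - z j)) ∧
      ∀ x : Fin N × Equiv.Perm (Fin 4), Equiv.Perm.sign x.2 = 1 →
        T.edgeProduct z x = 1 ∧ T.edgeAngle angle z x = 2 * Real.pi :=
  and_congr_right fun _ => ⟨fun h x => h x.1 x.2, fun h j π => h (j, π)⟩

end Edge

section Glue

variable {N : ℕ} (T : IdealTriangulation N) {B : Type} [CommRing B]

/-- The glueing isometry at the face `f` of the tetrahedron `j`, when all tetrahedra are in
standard position. -/
def standardGlue (z : Fin N → B) (j : Fin N) (f : Fin 4) : Matrix (Fin 2) (Fin 2) B :=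
  triangleMap (fun a => standardVertex (z (T.nbr j f)) (T.perm j f (f.succAbove a)))
    fun a => standardVertex (z j) (f.succAbove a)

/-- The isometry that places the last tetrahedron of a path, when all tetrahedra are in standard
position. -/
def standardDevelop (z : Fin N → B) : Fin N → List (Fin 4) → Matrix (Fin 2) (Fin 2) B
  | _, [] => 1
  | j, f :: γ => T.standardGlue z j f * standardDevelop z (T.nbr j f) γ

/-- The coordinate on `ℙ¹B` that puts the vertices `0, 1, 2` of a tetrahedron in standard position,
seen from one of its oriented edges, at `∞, 0, 1`. -/
def edgeNormalizer (z : Fin N → B) (x : Fin N × Equiv.Perm (Fin 4)) : Matrix (Fin 2) (Fin 2) B :=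
  normalizer fun a => standardVertex (z x.1) (x.2 a.castSucc)

variable {T} [StarRing B] [Algebra ℝ B] {z : Fin N → B}
  (hz : ∀ j, Spacelike (z j) ∧ Spacelike (1 - z j))
include hz

theorem spacelikeEdges_standardVertex_comp (j : Fin N) {ι : Type*} {f : ι → Fin 4}
    (hf : Function.Injective f) : SpacelikeEdges fun a => standardVertex (z j) (f a) :=
  (spacelikeEdges_standardVertex (hz j)).comp hf

theorem spacelike_det_standardGlue (j : Fin N) (f : Fin 4) :
    Spacelike (T.standardGlue z j f).det :=
  (spacelikeEdges_standardVertex_comp hz _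
    ((T.perm j f).injective.comp f.succAbove_right_injective)).spacelike_det_triangleMap
      (spacelikeEdges_standardVertex_comp hz _ f.succAbove_right_injective)

theorem samePoint_standardGlue (j : Fin N) (f : Fin 4) {a : Fin 4} (ha : a ≠ f) :
    SamePoint ((T.standardGlue z j f).mulVec (standardVertex (z (T.nbr j f)) (T.perm j f a)))
      (standardVertex (z j) a) := by
  obtain ⟨b, rfl⟩ := Fin.exists_succAbove_eq ha
  exact (spacelikeEdges_standardVertex_comp hz _ ((T.perm j f).injective.comp
    f.succAbove_right_injective)).generalPosition.samePoint_triangleMap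
      (spacelikeEdges_standardVertex_comp hz _ f.succAbove_right_injective).generalPosition b

theorem isUnit_det_edgeNormalizer (x : Fin N × Equiv.Perm (Fin 4)) :
    IsUnit (edgeNormalizer z x).det :=
  (spacelikeEdges_standardVertex_comp hz _
    (x.2.injective.comp (Fin.castSucc_injective 3))).generalPosition.isUnit_det_normalizer

theorem exists_edgeNormalizer_mul_eq_smul {x : Fin N × Equiv.Perm (Fin 4)}
    (hx : Equiv.Perm.sign x.2 = 1) :
    ∃ c : Bˣ, edgeNormalizer z x * T.standardGlue z x.1 (x.2 2) =
      (c : B) • (Matrix.diagonal ![edgeParameter (z x.1) (x.2 0) (x.2 1), 1] *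
        edgeNormalizer z (T.turn x)) := by
  have hcross := isCrossRatio_edgeParameter (hz x.1).1.isUnit (hz x.1).2.isUnit hx
  refine hcross.exists_normalizer_mul_eq_smul
    (spacelikeEdges_standardVertex_comp hz _ x.2.injective).generalPosition
    (spacelikeEdges_standardVertex_comp hz _
      ((T.turn x).2.injective.comp (Fin.castSucc_injective 3))).generalPosition fun a => ?_
  simp only [Function.comp, turn_snd_castSucc]
  exact samePoint_standardGlue hz _ _ (x.2.injective.ne (Fin.succAbove_ne 2 a))

theorem exists_edgeNormalizer_mul_prod_eq_smul {x : Fin N × Equiv.Perm (Fin 4)}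
    (hx : Equiv.Perm.sign x.2 = 1) (n : ℕ) :
    ∃ c : Bˣ, edgeNormalizer z x * ((List.range n).map fun i =>
        T.standardGlue z (T.around x i).1 ((T.around x i).2 2)).prod =
      (c : B) • (Matrix.diagonal ![∏ i ∈ Finset.range n,
        edgeParameter (z (T.around x i).1) ((T.around x i).2 0) ((T.around x i).2 1), 1] *
          edgeNormalizer z (T.around x n)) := by
  induction n with
  | zero => exact ⟨1, by simp [around, diagonal_one_one]⟩
  | succ n ih =>
    obtain ⟨c, hc⟩ := ih
    obtain ⟨d, hd⟩ := exists_edgeNormalizer_mul_eq_smul (T := T) hz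
      (x := T.around x n) (by rw [sign_around, hx])
    refine ⟨c * d, ?_⟩
    rw [List.range_succ, List.map_append, List.prod_append, List.map_singleton,
      List.prod_singleton, ← Matrix.mul_assoc, hc, Matrix.smul_mul, Matrix.mul_assoc, hd,
      Matrix.mul_smul, smul_smul, ← Matrix.mul_assoc, Matrix.diagonal_mul_diagonal, ← around_succ,
      Finset.prod_range_succ, Units.val_mul]
    congr 3
    ext k; fin_cases k <;> simp

theorem exists_prod_standardGlue_eq_smul_one {x : Fin N × Equiv.Perm (Fin 4)}
    (hx : Equiv.Perm.sign x.2 = 1)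
    (hprod : T.edgeProduct z x = 1) :
    ∃ c : Bˣ, ((List.range (T.valence x)).map fun i =>
      T.standardGlue z (T.around x i).1 ((T.around x i).2 2)).prod = (c : B) • 1 := by
  obtain ⟨c, hc⟩ := exists_edgeNormalizer_mul_prod_eq_smul (T := T) hz hx (T.valence x)
  rw [around_valence, ← edgeProduct, hprod, diagonal_one_one, Matrix.one_mul] at hc
  refine ⟨c, ((Matrix.isUnit_iff_isUnit_det _).2 (isUnit_det_edgeNormalizer hz x)).mul_left_cancel
    ?_⟩
  rw [hc, Matrix.mul_smul, Matrix.mul_one]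

end Glue

section Realization

variable {N : ℕ} {T : IdealTriangulation N} {B : Type} [CommRing B] [StarRing B] [Algebra ℝ B]
  {z : Fin N → B}

section

variable {angle : B → ℝ} (hz : z ∈ T.thurstonSolutions angle)

variable (T) in
/-- The realization of a solution of Thurston's equations by tetrahedra in standard position. -/
def standardRealization : T.Realization B where
  vertex j := standardVertex (z j)
  glue := T.standardGlue z
  ideal j := (spacelikeEdges_standardVertex (hz.1 j)).isIdealTetrahedron
  isometry := spacelike_det_standardGlue hz.1
  face j f _ := samePoint_standardGlue hz.1 j f
  edge j π hπ := exists_prod_standardGlue_eq_smul_one hz.1 hπ (hz.2 j π hπ).1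

theorem standardRealization_hasShapes : (T.standardRealization hz).HasShapes z :=
  fun j => hasShape_standardVertex (hz.1 j)

theorem standardRealization_totalAngle : (T.standardRealization hz).TotalAngle angle :=
  fun j π hπ => ⟨_, fun _ => hasShape_standardVertex_perm (hz.1 _)
    ((T.sign_around (j, π) _).trans hπ), (hz.2 j π hπ).2⟩

theorem standardRealization_develop (j : Fin N) (γ : List (Fin 4)) :
    (T.standardRealization hz).develop j γ = T.standardDevelop z j γ := by
  induction γ generalizing j with
  | nil => rfl
  | cons f γ ih => exact congrArg (T.standardGlue z j f * ·) (ih _)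

end

namespace Realization

variable (S : T.Realization B) (hz : ∀ j, Spacelike (z j) ∧ Spacelike (1 - z j))
  {A : Fin N → Matrix (Fin 2) (Fin 2) B} (hA : ∀ j, IsUnit (A j).det)
  (hS : ∀ j a, SamePoint ((A j).mulVec (S.vertex j a)) (standardVertex (z j) a))
include hz hA hS

theorem exists_mul_glue_eq_smul (j : Fin N) (f : Fin 4) :
    ∃ c : Bˣ, A j * S.glue j f = (c : B) • (T.standardGlue z j f * A (T.nbr j f)) := by
  have hv : GeneralPosition (S.vertex (T.nbr j f)) :=
    (spacelikeEdges_standardVertex (hz _)).generalPosition.of_samePoint_mulVec (hS _)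
  refine eq_smul_of_samePoint ?_
    (hv.comp ((T.perm j f).injective.comp f.succAbove_right_injective)) fun a => ?_
  · rw [Matrix.det_mul]
    exact (spacelike_det_standardGlue hz j f).isUnit.mul (hA _)
  · have ha := f.succAbove_ne a
    rw [← Matrix.mulVec_mulVec, ← Matrix.mulVec_mulVec]
    exact (((hS _ _).mulVec _).trans (samePoint_standardGlue hz j f ha)).trans
      (((S.face j f _ ha).mulVec _).trans (hS j _)).symm

theorem exists_mul_develop_eq_smul (j : Fin N) (γ : List (Fin 4)) :
    ∃ c : Bˣ, A j * S.develop j γ = (c : B) • (T.standardDevelop z j γ * A (T.walk j γ)) := by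
  induction γ generalizing j with
  | nil => exact ⟨1, by simp [develop, standardDevelop, walk]⟩
  | cons f γ ih =>
    obtain ⟨c, hc⟩ := ih (T.nbr j f)
    obtain ⟨d, hd⟩ := S.exists_mul_glue_eq_smul hz hA hS j f
    refine ⟨d * c, ?_⟩
    rw [develop, standardDevelop, walk, ← Matrix.mul_assoc, hd, Matrix.smul_mul, Matrix.mul_assoc,
      hc, Matrix.mul_smul, smul_smul, Units.val_mul, Matrix.mul_assoc]

end Realization

end Realization

end IdealTriangulation

/-! ## Collapse of the realizations -/

section Map

variable {R S : Type} [CommRing R] [CommRing S] (g : R →+* S)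

theorem standardVertex_map (z : R) (a : Fin 4) :
    standardVertex (g z) a = g ∘ standardVertex z a := by
  ext k; fin_cases a <;> fin_cases k <;> simp [standardVertex]

theorem normalizer_map (v : Fin 3 → Fin 2 → R) :
    normalizer (fun a => g ∘ v a) = (normalizer v).map g := by
  ext i k; fin_cases i <;> fin_cases k <;> simp [normalizer, wedge]

theorem triangleMap_map (v w : Fin 3 → Fin 2 → R) :
    triangleMap (fun a => g ∘ v a) (fun a => g ∘ w a) = (triangleMap v w).map g := by
  rw [triangleMap, triangleMap, normalizer_map, normalizer_map, Matrix.map_mul]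
  exact congrArg (· * (normalizer v).map g) (g.map_adjugate _).symm

variable {m n : Type*} [Fintype n]

theorem mulVec_map (A : Matrix m n R) (v : n → R) :
    (A.map g).mulVec (g ∘ v) = g ∘ A.mulVec v :=
  funext fun i => (g.map_mulVec A v i).symm

theorem inv_map_nonsing_inv [DecidableEq n] {A : Matrix n n R} (hA : IsUnit A.det) :
    (A⁻¹.map g)⁻¹ = A.map g := by
  refine Matrix.inv_eq_right_inv ?_
  rw [← Matrix.map_mul, Matrix.nonsing_inv_mul _ hA, Matrix.map_one _ (map_zero g) (map_one g)]

theorem SamePoint.map {v w : Fin 2 → R} (h : SamePoint v w) : SamePoint (g ∘ v) (g ∘ w) := by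
  obtain ⟨c, rfl⟩ := h
  exact ⟨Units.map g c, by ext; simp⟩

theorem spacelike_det_map [DecidableEq n] [Algebra ℝ R] [StarRing R] [StarModule ℝ R]
    {A : Matrix n n ℝ} (hA : IsUnit A.det) :
    Spacelike (A.map (algebraMap ℝ R)).det := by
  have hdet : (A.map (algebraMap ℝ R)).det = algebraMap ℝ R A.det :=
    ((algebraMap ℝ R).map_det A).symm
  refine ⟨A.det * A.det, mul_self_pos.2 hA.ne_zero, ?_⟩
  rw [hdet, ← algebraMap_star_comm, star_trivial, map_mul]

namespace IdealTriangulation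

variable {N : ℕ} (T : IdealTriangulation N)

theorem standardGlue_map (z : Fin N → R) (j : Fin N) (f : Fin 4) :
    T.standardGlue (fun i => g (z i)) j f = (T.standardGlue z j f).map g := by
  simp only [standardGlue, standardVertex_map, triangleMap_map]

theorem standardDevelop_map (z : Fin N → R) (j : Fin N) (γ : List (Fin 4)) :
    T.standardDevelop (fun i => g (z i)) j γ = (T.standardDevelop z j γ).map g := by
  induction γ generalizing j with
  | nil => simp [standardDevelop]
  | cons f γ ih => rw [standardDevelop, standardDevelop, ih, standardGlue_map, Matrix.map_mul]

end IdealTriangulation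

end Map

section Continuity

variable {B : Type} [CommRing B] [TopologicalSpace B]

theorem continuous_standardVertex (a : Fin 4) : Continuous fun z : B => standardVertex z a := by
  unfold standardVertex; fun_prop

variable [IsTopologicalRing B]

theorem continuous_normalizer : Continuous (normalizer : (Fin 3 → Fin 2 → B) → _) := by
  refine continuous_matrix fun i k => ?_
  fin_cases i <;> fin_cases k <;>
    simp only [normalizer, wedge, Fin.zero_eta, Fin.mk_one, Matrix.of_apply, Matrix.cons_val] <;>
    fun_prop

namespace IdealTriangulation

variable {N : ℕ} (T : IdealTriangulation N)

theorem continuous_standardGlue (j : Fin N) (f : Fin 4) :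
    Continuous fun z : Fin N → B => T.standardGlue z j f := by
  have h {i : Fin N} {s : Fin 3 → Fin 4} :
      Continuous fun z : Fin N → B => normalizer fun a => standardVertex (z i) (s a) :=
    continuous_normalizer.comp <| continuous_pi fun a =>
      (continuous_standardVertex _).comp (continuous_apply i)
  exact h.matrix_adjugate.matrix_mul h

theorem continuous_standardDevelop (j : Fin N) (γ : List (Fin 4)) :
    Continuous fun z : Fin N → B => T.standardDevelop z j γ := by
  induction γ generalizing j with
  | nil => exact continuous_const
  | cons f γ ih => exact (T.continuous_standardGlue j f).matrix_mul (ih _)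

end IdealTriangulation

end Continuity

namespace IdealTriangulation

variable {N : ℕ} {T : IdealTriangulation N}

namespace Realization

variable {B : Type} [CommRing B] [StarRing B] [Algebra ℝ B] {z : Fin N → B}
  (S : T.Realization B) (hz : ∀ j, Spacelike (z j) ∧ Spacelike (1 - z j))
  {A : Fin N → Matrix (Fin 2) (Fin 2) B} (hA : ∀ j, IsUnit (A j).det)
  (hS : ∀ j a, SamePoint ((A j).mulVec (S.vertex j a)) (standardVertex (z j) a))
include hz hA hS

theorem exists_develop_eq_smul (j : Fin N) (γ : List (Fin 4)) :
    ∃ c : Bˣ, S.develop j γ = (c : B) • ((A j)⁻¹ * T.standardDevelop z j γ * A (T.walk j γ)) := by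
  obtain ⟨c, hc⟩ := S.exists_mul_develop_eq_smul hz hA hS j γ
  refine ⟨c, ?_⟩
  rw [Matrix.mul_assoc, ← Matrix.mul_smul, ← hc, Matrix.nonsing_inv_mul_cancel_left _ _ (hA j)]

theorem samePoint_developedVertex (j : Fin N) (γ : List (Fin 4)) (a : Fin 4) :
    SamePoint (((A j)⁻¹ * T.standardDevelop z j γ).mulVec (standardVertex (z (T.walk j γ)) a))
      (S.developedVertex j γ a) := by
  obtain ⟨c, hc⟩ := S.exists_develop_eq_smul hz hA hS j γ
  rw [developedVertex, hc, Matrix.smul_mulVec, ← Matrix.mulVec_mulVec _ _ (A _)]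
  exact ((hS _ a).symm.mulVec _).trans ⟨c, rfl⟩

end Realization

section Collapse

theorem exists_tendsto_smul {R M X : Type*} [Monoid R] [MulAction R M] [TopologicalSpace M]
    [ContinuousConstSMul R M] {u v : M} (h : ∃ c : Rˣ, v = (c : R) • u) {l : Filter X} {f : X → M}
    (hf : Tendsto f l (𝓝 u)) : ∃ c : X → Rˣ, Tendsto (fun t => (c t : R) • f t) l (𝓝 v) := by
  obtain ⟨c, rfl⟩ := h
  exact ⟨fun _ => c, hf.const_smul (c : R)⟩

variable {B : Type} [CommRing B] [StarRing B] [Algebra ℝ B] [StarModule ℝ B] [TopologicalSpace B]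
  [IsTopologicalRing B] {z : Fin N → ℝ} {angle : B → ℝ} {ζ : Set.Ioi (0 : ℝ) → Fin N → B}

theorem collapsesTo_standardRealization (hz : ∀ j, Spacelike (z j) ∧ Spacelike (1 - z j))
    (hζ : ∀ t, ζ t ∈ T.thurstonSolutions angle)
    (hlim : Tendsto ζ (comap Subtype.val (𝓝 0)) (𝓝 fun j => algebraMap ℝ B (z j)))
    {F : T.TransverselyHyperbolicFoliation} (hF : F.HasShapes z) :
    CollapsesTo (fun t => T.standardRealization (hζ t)) F := by
  choose A hA hAF using fun j => (hF j).exists_samePoint_standardVertex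
  have hAu : ∀ j, IsUnit (A j).det := fun j => (hA j).isUnit
  have hcont := T.continuous_standardDevelop (B := B)
  refine ⟨fun _ j => (A j)⁻¹.map (algebraMap ℝ B),
    fun _ j => spacelike_det_map ((A j).isUnit_nonsing_inv_det (hAu j)), fun j γ a => ?_,
    fun j γ hγ => ?_⟩
  · refine exists_tendsto_smul
      ((F.toRealization.samePoint_developedVertex hz hAu hAF j γ a).map (algebraMap ℝ B)) ?_
    rw [← mulVec_map, Matrix.map_mul, ← Matrix.mulVec_mulVec, ← standardVertex_map,
      ← standardDevelop_map]
    simp only [Realization.developedVertex, standardRealization_develop]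
    exact (((continuous_const (y := (A j)⁻¹.map (algebraMap ℝ B))).matrix_mulVec
      ((hcont j γ).matrix_mulVec ((continuous_standardVertex a).comp
        (continuous_apply (T.walk j γ))))).tendsto _).comp hlim
  · obtain ⟨c, hc⟩ := F.toRealization.exists_develop_eq_smul hz hAu hAF j γ
    have hFdev : (F.develop j γ).map (algebraMap ℝ B) = algebraMap ℝ B c •
        ((A j)⁻¹.map (algebraMap ℝ B) * T.standardDevelop (fun i => algebraMap ℝ B (z i)) j γ *
          (A j).map (algebraMap ℝ B)) := by
      rw [hc, hγ, standardDevelop_map, ← Matrix.map_mul, ← Matrix.map_mul,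
        Matrix.map_smul' _ _ _ (map_mul _)]
    refine exists_tendsto_smul ⟨Units.map (algebraMap ℝ B).toMonoidHom c, hFdev⟩ ?_
    simp only [standardRealization_develop, inv_map_nonsing_inv _ (hAu j)]
    exact (((continuous_const.matrix_mul (hcont j γ)).matrix_mul continuous_const).tendsto _).comp
      hlim

end Collapse

end IdealTriangulation

/-! ## Curves of solutions -/

section Smooth

variable {E : Type*} [NormedAddCommGroup E] [NormedSpace ℝ E] {D : Set E} {z v : E}

/- Composing `φ` with a linear left inverse of its derivative gives a local diffeomorphism of the
parameter space, so that `φ` has a local left inverse, differentiable at `z`. -/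
theorem exists_localLeftInverse {F : Type*} [NormedAddCommGroup F] [NormedSpace ℝ F]
    [CompleteSpace F] {φ : F → E} {L : F →L[ℝ] E} {p : F} (hφ : HasStrictFDerivAt φ L p)
    (hL : L.HasLeftInverse) :
    ∃ ρ : E → F, DifferentiableAt ℝ ρ (φ p) ∧ ∀ᶠ q in 𝓝 p, ρ (φ q) = q := by
  have hψ : HasStrictFDerivAt (fun q => hL.leftInverse (φ q))
      (ContinuousLinearEquiv.refl ℝ F : F →L[ℝ] F) p := by
    refine (hL.leftInverse.hasStrictFDerivAt.comp p hφ).congr_fderiv ?_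
    ext q
    exact hL.leftInverse_leftInverse q
  exact ⟨fun y => hψ.localInverse _ _ _ (hL.leftInverse y),
    hψ.to_localInverse.hasFDerivAt.differentiableAt.comp (φ p)
      hL.leftInverse.differentiableAt, hψ.eventually_left_inverse⟩

theorem hasLeftInverse_of_injective {F : Type*} [NormedAddCommGroup F] [NormedSpace ℝ F]
    [FiniteDimensional ℝ F] {L : F →L[ℝ] E} (hL : Function.Injective L) : L.HasLeftInverse := by
  let e := (LinearEquiv.ofInjective (L : F →ₗ[ℝ] E) hL).toContinuousLinearEquiv
  obtain ⟨P, hP⟩ := Submodule.ClosedComplemented.of_finiteDimensional (𝕜 := ℝ)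
    (LinearMap.range (L : F →ₗ[ℝ] E))
  refine ⟨(e.symm : LinearMap.range (L : F →ₗ[ℝ] E) →L[ℝ] F).comp P, fun q => ?_⟩
  exact (congrArg e.symm (hP (e q))).trans (e.symm_apply_apply q)

theorem IsTangentVector.mem_range_of_map_nhds_eq (hv : IsTangentVector D z v) {F : Type*}
    [NormedAddCommGroup F] [NormedSpace ℝ F] [CompleteSpace F] {φ : F → E} {L : F →L[ℝ] E}
    {p : F} (hφ : HasStrictFDerivAt φ L p) (hL : L.HasLeftInverse) (hp : φ p = z)
    (hmap : map φ (𝓝 p) = 𝓝[D] z) : v ∈ Set.range L := by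
  obtain ⟨γ, hγ0, hγ, hγD⟩ := hv
  obtain ⟨ρ, hρ, hρφ⟩ := exists_localLeftInverse hφ hL
  have hφρ : ∀ᶠ y in 𝓝[D] z, φ (ρ y) = y := by
    rw [← hmap, eventually_map]
    exact hρφ.mono fun q hq => congrArg φ hq
  have hγz : Tendsto γ (𝓝 0) (𝓝[D] z) :=
    tendsto_nhdsWithin_iff.2 ⟨hγ0 ▸ hγ.continuousAt.tendsto, hγD⟩
  have hlift : HasDerivAt (ρ ∘ γ) (fderiv ℝ ρ z v) 0 := by
    rw [hp, ← hγ0] at hρ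
    exact hγ0 ▸ hρ.hasFDerivAt.comp_hasDerivAt 0 hγ
  have hρz : ρ (γ 0) = p := by rw [hγ0, ← hp]; exact hρφ.self_of_nhds
  have hφγ : HasDerivAt (φ ∘ ρ ∘ γ) (L (fderiv ℝ ρ z v)) 0 :=
    HasFDerivAt.comp_hasDerivAt 0 (by simpa [hρz] using hφ.hasFDerivAt) hlift
  exact ⟨_, hφγ.unique (hγ.congr_of_eventuallyEq (hγz.eventually hφρ))⟩

theorem IsSmoothPoint.exists_analytic_curve (hD : IsSmoothPoint D z)
    (hv : IsTangentVector D z v) :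
    ∃ c : ℝ → E, AnalyticAt ℝ c 0 ∧ c 0 = z ∧ HasDerivAt c v 0 ∧ ∀ᶠ s in 𝓝 0, c s ∈ D := by
  obtain ⟨d, φ, hφ, h0, hinj, hmap⟩ := hD
  obtain ⟨u, rfl⟩ := hv.mem_range_of_map_nhds_eq hφ.hasStrictFDerivAt
    (hasLeftInverse_of_injective hinj) h0 hmap
  have hφD : ∀ᶠ p in 𝓝 0, φ p ∈ D := by
    rw [← eventually_map (P := fun y => y ∈ D), hmap]
    exact self_mem_nhdsWithin
  have hline : HasDerivAt (fun s : ℝ => s • u) u 0 := by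
    simpa only [one_smul] using! (hasDerivAt_id (0 : ℝ)).smul_const u
  have hline0 : Tendsto (fun s : ℝ => s • u) (𝓝 0) (𝓝 0) := by
    simpa only [zero_smul] using hline.continuousAt.tendsto
  refine ⟨fun s => φ (s • u), ?_, by simp only [zero_smul, h0], ?_, hline0.eventually hφD⟩
  · exact AnalyticAt.fun_comp (by rwa [zero_smul]) (by fun_prop)
  · refine HasFDerivAt.comp_hasDerivAt (0 : ℝ) ?_ hline
    rw [zero_smul]
    exact hφ.differentiableAt.hasFDerivAt

end Smooth

section Analysis

theorem exists_complexification {f : ℝ → ℝ} {x : ℝ} (hf : AnalyticAt ℝ f x) :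
    ∃ F : ℂ → ℂ, AnalyticAt ℂ F x ∧ ∀ᶠ s : ℝ in 𝓝 x, F s = f s := by
  obtain ⟨p, hp⟩ := hf
  rw [hasFPowerSeriesAt_iff'] at hp
  refine ⟨fun w => ∑' n, (w - x) ^ n * (p.coeff n : ℂ),
    ⟨FormalMultilinearSeries.ofScalars ℂ (fun n => (p.coeff n : ℂ)), ?_⟩, ?_⟩
  · rw [hasFPowerSeriesAt_iff']
    obtain ⟨ε, hε, h⟩ := Metric.eventually_nhds_iff.1 hp
    have hdist : dist (x + ε / 2) x < ε := by
      rw [Real.dist_eq, add_sub_cancel_left, abs_of_pos (half_pos hε)]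
      exact half_lt_self hε
    have hsum : Summable fun n => ‖(x + ε / 2 - x) ^ n • p.coeff n‖ := (h hdist).summable.norm
    filter_upwards [Metric.ball_mem_nhds (x : ℂ) (half_pos hε)] with w hw
    simp only [FormalMultilinearSeries.coeff_ofScalars, smul_eq_mul]
    refine Summable.hasSum (hsum.of_norm_bounded fun n => ?_)
    rw [norm_mul, norm_smul, norm_pow, norm_pow, Complex.norm_real, add_sub_cancel_left,
      Real.norm_of_nonneg (half_pos hε).le]
    gcongr
    exact (mem_ball_iff_norm.1 hw).le
  · filter_upwards [hp] with s hs
    rw [← hs.tsum_eq, Complex.ofReal_tsum]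
    exact tsum_congr fun n => by push_cast [smul_eq_mul]; rfl

theorem exists_complexification_pi {ι : Type*} [Fintype ι] {f : ℝ → ι → ℝ} {x : ℝ}
    (hf : AnalyticAt ℝ f x) :
    ∃ F : ℂ → ι → ℂ, AnalyticAt ℂ F x ∧ ∀ᶠ s : ℝ in 𝓝 x, F s = fun j => (f s j : ℂ) := by
  choose F hF hFf using fun j => exists_complexification (analyticAt_pi_iff.1 hf j)
  refine ⟨fun w j => F j w, analyticAt_pi_iff.2 hF, ?_⟩
  filter_upwards [eventually_all.2 hFf] with s hs using funext hs

section Complex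

variable {E : Type*} [NormedAddCommGroup E] [NormedSpace ℂ E] {F G : ℂ → E} {x : ℝ}

theorem hasDerivAt_of_hasDerivAt_ofReal {v : E} (hF : DifferentiableAt ℂ F x)
    (hv : HasDerivAt (fun s : ℝ => F s) v x) : HasDerivAt F v x := by
  have h : HasDerivAt (fun s : ℝ => F s) ((1 : ℂ) • deriv F x) x :=
    hF.hasDerivAt.scomp x Complex.ofRealCLM.hasDerivAt
  rw [← h.unique hv, one_smul]
  exact hF.hasDerivAt

theorem eventually_eq_of_eventually_ofReal (hF : AnalyticAt ℂ F x) (hG : AnalyticAt ℂ G x)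
    (h : ∀ᶠ s : ℝ in 𝓝 x, F s = G s) : ∀ᶠ w in 𝓝 (x : ℂ), F w = G w := by
  have hofReal : Tendsto (fun s : ℝ => (s : ℂ)) (𝓝[≠] x) (𝓝[≠] (x : ℂ)) :=
    Complex.continuous_ofReal.continuousAt.continuousWithinAt.tendsto_nhdsWithin
      fun s hs => mt Complex.ofReal_inj.1 hs
  exact (hF.frequently_eq_iff_eventually_eq hG).1
    (hofReal.frequently (h.filter_mono nhdsWithin_le_nhds).frequently)

end Complex

theorem eventually_pos_of_hasDerivAt {f : ℝ → ℝ} {v x : ℝ} (hf : HasDerivAt f v x)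
    (h0 : f x = 0) (hv : 0 < v) : ∀ᶠ s in 𝓝[>] x, 0 < f s := by
  have hsign := eventually_nhdsWithin_sign_eq_of_deriv_pos (hf.deriv.symm ▸ hv) h0
  filter_upwards [nhdsWithin_le_nhds hsign, self_mem_nhdsWithin] with s hs hxs
  rwa [sign_pos (sub_pos.2 hxs), sign_eq_one_iff] at hs

theorem exists_reparametrization {U : Set ℝ} (hU : U ∈ 𝓝 0) {n : WithTop ℕ∞} :
    ∃ η : ℝ → ℝ, ContDiff ℝ n η ∧ η 0 = 0 ∧ HasDerivAt η 1 0 ∧ (∀ t, η t ∈ U) ∧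
      ∀ t, 0 < t → 0 < η t := by
  obtain ⟨δ, hδ, hδU⟩ := Metric.mem_nhds_iff.1 hU
  refine ⟨fun t => δ / 2 * Real.arctan (2 / δ * t), ?_, ?_, ?_, fun t => hδU ?_, fun t ht => ?_⟩
  · exact contDiff_const.mul (Real.contDiff_arctan.comp (contDiff_const.mul contDiff_id))
  · simp only [mul_zero, Real.arctan_zero]
  · refine ((((hasDerivAt_id (0 : ℝ)).const_mul (2 / δ)).arctan).const_mul (δ / 2)).congr_deriv ?_
    simp only [id_eq, mul_zero]
    field_simp
    norm_num
  · have harctan : |Real.arctan (2 / δ * t)| < 2 := by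
      rw [abs_lt]
      constructor <;> linarith [Real.neg_pi_div_two_lt_arctan (2 / δ * t),
        Real.arctan_lt_pi_div_two (2 / δ * t), Real.pi_le_four]
    rw [mem_ball_zero_iff, Real.norm_eq_abs, abs_mul, abs_of_pos (half_pos hδ)]
    linarith [mul_lt_mul_of_pos_left harctan (half_pos hδ)]
  · exact mul_pos (half_pos hδ) (Real.arctan_pos.2 (by positivity))

theorem exists_contDiff_curve {E : Type*} [NormedAddCommGroup E] [NormedSpace ℝ E] {Γ : ℝ → E}
    {v : E} {n : WithTop ℕ∞} {P : E → Prop} (hΓ : ∀ᶠ s in 𝓝 0, ContDiffAt ℝ n Γ s)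
    (hv : HasDerivAt Γ v 0) (hP : ∀ᶠ s in 𝓝[>] 0, P (Γ s)) :
    ∃ ζ : ℝ → E, ContDiff ℝ n ζ ∧ ζ 0 = Γ 0 ∧ HasDerivAt ζ v 0 ∧ ∀ t, 0 < t → P (ζ t) := by
  obtain ⟨η, hη, hη0, hη', hηU, hηpos⟩ :=
    exists_reparametrization (hΓ.and (eventually_nhdsWithin_iff.1 hP)) (n := n)
  refine ⟨Γ ∘ η, ?_, congrArg Γ hη0, ?_, fun t ht => (hηU t).2 (hηpos t ht)⟩
  · exact contDiff_iff_contDiffAt.2 fun t => (hηU t).1.comp t hη.contDiffAt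
  · simpa only [one_smul] using hv.scomp_of_eq 0 hη' hη0.symm

end Analysis

/-! ## Pseudo-complex solutions -/

section EdgeParameter

theorem map_ringInverse {R S : Type*} [Semiring R] [Semiring S] (g : R →+* S) {u : R}
    (hu : IsUnit u) : g (Ring.inverse u) = Ring.inverse (g u) := by
  obtain ⟨u, rfl⟩ := hu
  rw [Ring.inverse_unit]
  exact (Ring.inverse_unit (Units.map (g : R →* S) u)).symm

theorem edgeParameter_map {R S : Type} [CommRing R] [CommRing S] (g : R →+* S) {z : R}
    (hz : IsUnit z) (hz' : IsUnit (1 - z)) (a b : Fin 4) :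
    g (edgeParameter z a b) = edgeParameter (g z) a b := by
  unfold edgeParameter
  split_ifs
  · rfl
  · rw [map_ringInverse g hz', map_sub, map_one]
  · rw [map_mul, map_ringInverse g hz, map_sub, map_one]

end EdgeParameter

namespace IdealTriangulation

theorem edgeProduct_map {N : ℕ} (T : IdealTriangulation N) {R S : Type} [CommRing R] [CommRing S]
    (g : R →+* S) {z : Fin N → R}
    (hz : ∀ j, IsUnit (z j)) (hz' : ∀ j, IsUnit (1 - z j)) (x : Fin N × Equiv.Perm (Fin 4)) :
    g (T.edgeProduct z x) = T.edgeProduct (fun j => g (z j)) x :=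
  (map_prod g _ _).trans
    (Finset.prod_congr rfl fun _ _ => edgeParameter_map g (hz _) (hz' _) _ _)

end IdealTriangulation

namespace PseudoComplex

theorem continuous_iff {X : Type*} [TopologicalSpace X] {f : X → PseudoComplex} :
    Continuous f ↔ Continuous (fun x => (f x).re) ∧ Continuous fun x => (f x).im :=
  continuous_induced_rng.trans continuous_prodMk

instance : IsTopologicalRing PseudoComplex := by
  obtain ⟨hre, him⟩ := continuous_iff.1 (continuous_id (X := PseudoComplex))
  simp only [id_eq] at hre him
  refine { continuous_add := ?_, continuous_mul := ?_, continuous_neg := ?_ } <;>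
    simp only [continuous_iff, QuadraticAlgebra.re_add, QuadraticAlgebra.im_add,
      QuadraticAlgebra.re_mul, QuadraticAlgebra.im_mul, QuadraticAlgebra.re_neg,
      QuadraticAlgebra.im_neg] <;>
    constructor <;> fun_prop

instance : StarModule ℝ PseudoComplex where
  star_smul r z := by ext <;> simp

/-- The ring homomorphism `a + bτ ↦ a + b`, the first component of the isomorphism of
`ℝ + ℝτ` with `ℝ × ℝ`. -/
def left : PseudoComplex →+* ℝ where
  toFun z := z.re + z.im
  map_one' := add_zero 1
  map_zero' := add_zero 0
  map_add' z w := by simp only [QuadraticAlgebra.re_add, QuadraticAlgebra.im_add]; ring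
  map_mul' z w := by simp only [QuadraticAlgebra.re_mul, QuadraticAlgebra.im_mul]; ring

/-- The ring homomorphism `a + bτ ↦ a - b`, the second component of the isomorphism of
`ℝ + ℝτ` with `ℝ × ℝ`. -/
def right : PseudoComplex →+* ℝ where
  toFun z := z.re - z.im
  map_one' := sub_zero 1
  map_zero' := sub_zero 0
  map_add' z w := by simp only [QuadraticAlgebra.re_add, QuadraticAlgebra.im_add]; ring
  map_mul' z w := by simp only [QuadraticAlgebra.re_mul, QuadraticAlgebra.im_mul]; ring

/-- The pseudo-complex number with given images under `left` and `right`. -/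
def ofPair (x y : ℝ) : PseudoComplex := ⟨(x + y) / 2, (x - y) / 2⟩

theorem left_apply (z : PseudoComplex) : left z = z.re + z.im := rfl

theorem right_apply (z : PseudoComplex) : right z = z.re - z.im := rfl

theorem left_ofPair (x y : ℝ) : left (ofPair x y) = x := by
  simp only [left_apply, ofPair]; ring

theorem right_ofPair (x y : ℝ) : right (ofPair x y) = y := by
  simp only [right_apply, ofPair]; ring

theorem ofPair_self (x : ℝ) : ofPair x x = algebraMap ℝ PseudoComplex x := by
  ext <;> simp [ofPair]

theorem ext_left_right {z w : PseudoComplex} (hl : left z = left w) (hr : right z = right w) :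
    z = w := by
  simp only [left_apply, right_apply] at hl hr
  exact QuadraticAlgebra.ext (by linarith) (by linarith)

theorem spacelike_iff {z : PseudoComplex} : Spacelike z ↔ 0 < left z * right z := by
  have hnorm : z * star z = algebraMap ℝ PseudoComplex (left z * right z) := by
    ext <;> simp [left_apply, right_apply] <;> ring
  refine ⟨fun ⟨r, hr, h⟩ => ?_, fun h => ⟨_, h, hnorm⟩⟩
  rwa [FaithfulSMul.algebraMap_injective ℝ PseudoComplex (hnorm.symm.trans h)]

theorem pseudoAngle_eq_realAngle_left {w : PseudoComplex} (hw : Spacelike w) :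
    pseudoAngle w = realAngle (left w) := by
  have hre : 2 * w.re = left w + right w := by rw [left_apply, right_apply]; ring
  have hiff : w.re < 0 ↔ left w < 0 := by
    rcases pos_and_pos_or_neg_and_neg_of_mul_pos (spacelike_iff.1 hw) with ⟨h, h'⟩ | ⟨h, h'⟩ <;>
      constructor <;> intro <;> linarith
  simp only [pseudoAngle, realAngle, hiff]

end PseudoComplex

namespace IdealTriangulation

open PseudoComplex

variable {N : ℕ} {T : IdealTriangulation N}

theorem mem_thurstonSolutions_pseudoAngle {w : Fin N → PseudoComplex}
    (hw : ∀ j, Spacelike (w j) ∧ Spacelike (1 - w j))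
    (hl : (fun j => left (w j)) ∈ T.realDeformationVariety)
    (hr : (fun j => right (w j)) ∈ T.realDeformationVariety) :
    w ∈ T.thurstonSolutions pseudoAngle := by
  obtain ⟨-, hl⟩ := T.mem_thurstonSolutions_iff.1 hl
  obtain ⟨-, hr⟩ := T.mem_thurstonSolutions_iff.1 hr
  have hunit : ∀ j, IsUnit (w j) := fun j => (hw j).1.isUnit
  have hunit' : ∀ j, IsUnit (1 - w j) := fun j => (hw j).2.isUnit
  refine T.mem_thurstonSolutions_iff.2 ⟨hw, fun x hx => ⟨ext_left_right ?_ ?_, ?_⟩⟩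
  · rw [T.edgeProduct_map left hunit hunit', (hl x hx).1, map_one]
  · rw [T.edgeProduct_map right hunit hunit', (hr x hx).1, map_one]
  · rw [← (hl x hx).2]
    refine Finset.sum_congr rfl fun i _ => ?_
    rw [pseudoAngle_eq_realAngle_left (spacelike_edgeParameter (hw _) _ _),
      edgeParameter_map left (hunit _) (hunit' _)]

theorem spacelike_ofPair {x y : ℝ} (h : 0 < x * y) : Spacelike (ofPair x y) := by
  rwa [spacelike_iff, left_ofPair, right_ofPair]

theorem eventually_ofPair_mem_thurstonSolutions {c : ℝ → Fin N → ℝ} (hc : ContinuousAt c 0)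
    (hcD : ∀ᶠ s in 𝓝 0, c s ∈ T.realDeformationVariety) :
    ∀ᶠ s in 𝓝 0, (fun j => ofPair (c s j) (c (-s) j)) ∈ T.thurstonSolutions pseudoAngle := by
  have hneg : Tendsto (fun s : ℝ => -s) (𝓝 0) (𝓝 0) := continuous_neg.tendsto' 0 0 neg_zero
  have hprod : ∀ {f : ℝ → ℝ}, ContinuousAt f 0 → IsUnit (f 0) → ∀ᶠ s in 𝓝 0, 0 < f s * f (-s) :=
    fun hf h0 => (hf.tendsto.mul (hf.tendsto.comp hneg)).eventually
      (lt_mem_nhds (mul_self_pos.2 h0.ne_zero))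
  have hcj : ∀ j, ContinuousAt (fun s => c s j) 0 := continuousAt_pi.1 hc
  have hspace : ∀ᶠ s in 𝓝 0, ∀ j, 0 < c s j * c (-s) j ∧ 0 < (1 - c s j) * (1 - c (-s) j) :=
    eventually_all.2 fun j => (hprod (hcj j) (hcD.self_of_nhds.1 j).1.isUnit).and
      (hprod (f := fun s => 1 - c s j) (continuousAt_const.sub (hcj j))
        (hcD.self_of_nhds.1 j).2.isUnit)
  filter_upwards [hspace, hcD, hneg.eventually hcD] with s hs hsl hsr
  refine mem_thurstonSolutions_pseudoAngle (fun j => ⟨spacelike_ofPair (hs j).1, ?_⟩) ?_ ?_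
  · rw [spacelike_iff, map_sub, map_sub, map_one, map_one, left_ofPair, right_ofPair]
    exact (hs j).2
  · simpa only [left_ofPair] using hsl
  · simpa only [right_ofPair] using hsr

theorem exists_pseudoComplex_path {z v : Fin N → ℝ} (hpos : ∀ j, 0 < v j) {c : ℝ → Fin N → ℝ}
    (hc : AnalyticAt ℝ c 0) (hc0 : c 0 = z) (hcv : HasDerivAt c v 0)
    (hcD : ∀ᶠ s in 𝓝 0, c s ∈ T.realDeformationVariety) :
    ∃ ξ : ℝ → Fin N → PseudoComplex,
      ContDiff ℝ ∞ (fun t j => (ξ t j).re) ∧ ContDiff ℝ ∞ (fun t j => (ξ t j).im) ∧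
      (∀ j, ξ 0 j = algebraMap ℝ PseudoComplex (z j)) ∧
      (∀ j, HasDerivAt (fun t => (ξ t j).re) 0 0 ∧ HasDerivAt (fun t => (ξ t j).im) (v j) 0) ∧
      ∀ t, 0 < t → ξ t ∈ T.thurstonSolutions pseudoAngle ∧ ∀ j, 0 < (ξ t j).im := by
  have hcv' : HasDerivAt (fun s => c (-s)) (-v) 0 :=
    (hcv.scomp_of_eq (0 : ℝ) (hasDerivAt_neg 0) neg_zero.symm).congr_deriv (neg_one_smul ℝ v)
  have hneg : Tendsto (fun s : ℝ => -s) (𝓝 0) (𝓝 0) := continuous_neg.tendsto' 0 0 neg_zero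
  have hsmooth : ∀ᶠ s in 𝓝 0, ContDiffAt ℝ ∞ (fun s => (c s, c (-s))) s := by
    filter_upwards [hc.eventually_analyticAt, hneg.eventually hc.eventually_analyticAt] with s
      hs hs'
    exact hs.contDiffAt.prodMk (hs'.contDiffAt.comp s contDiff_neg.contDiffAt)
  have him : ∀ᶠ s in 𝓝[>] 0, ∀ j, 0 < (c s j - c (-s) j) / 2 := by
    refine eventually_all.2 fun j => eventually_pos_of_hasDerivAt (v := v j) ?_ ?_ (hpos j)
    · refine (((hasDerivAt_pi.1 hcv j).sub (hasDerivAt_pi.1 hcv' j)).div_const 2).congr_deriv ?_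
      simp only [Pi.neg_apply]
      ring
    · simp only [neg_zero, sub_self, zero_div]
  obtain ⟨ζ, hζ, hζ0, hζ', hζP⟩ := exists_contDiff_curve
    (P := fun y => (fun j => ofPair (y.1 j) (y.2 j)) ∈ T.thurstonSolutions pseudoAngle ∧
      ∀ j, 0 < (ofPair (y.1 j) (y.2 j)).im) hsmooth (hcv.prodMk hcv')
    ((eventually_nhdsWithin_of_eventually_nhds
      (eventually_ofPair_mem_thurstonSolutions hc.continuousAt hcD)).and him)
  have hl : ∀ j, HasDerivAt (fun t => (ζ t).1 j) (v j) 0 := hasDerivAt_pi.1 hζ'.fst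
  have hr : ∀ j, HasDerivAt (fun t => (ζ t).2 j) (-v j) 0 := hasDerivAt_pi.1 hζ'.snd
  refine ⟨fun t j => ofPair ((ζ t).1 j) ((ζ t).2 j), contDiff_pi.2 fun j => ?_,
    contDiff_pi.2 fun j => ?_, fun j => ?_, fun j => ⟨?_, ?_⟩, hζP⟩
  · exact ((contDiff_pi.1 hζ.fst j).add (contDiff_pi.1 hζ.snd j)).div_const 2
  · exact ((contDiff_pi.1 hζ.fst j).sub (contDiff_pi.1 hζ.snd j)).div_const 2
  · simp only [hζ0, neg_zero, hc0, ofPair_self]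
  · exact (((hl j).add (hr j)).div_const 2).congr_deriv (by ring)
  · exact (((hl j).sub (hr j)).div_const 2).congr_deriv (by ring)

end IdealTriangulation

/-! ## Complex solutions -/

theorem isUnit_edgeParameter {R : Type} [CommRing R] {z : R} (hz : IsUnit z)
    (hz' : IsUnit (1 - z)) (a b : Fin 4) : IsUnit (edgeParameter z a b) := by
  unfold edgeParameter
  split_ifs
  · exact hz
  · exact hz'.ringInverse
  · exact (neg_sub 1 z ▸ hz'.neg).mul hz.ringInverse

theorem analyticAt_edgeParameter {𝕜 : Type} {E : Type*} [NontriviallyNormedField 𝕜]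
    [NormedAddCommGroup E] [NormedSpace 𝕜 E] {f : E → 𝕜} {x : E} (hf : AnalyticAt 𝕜 f x)
    (h0 : f x ≠ 0) (h1 : 1 - f x ≠ 0) (a b : Fin 4) :
    AnalyticAt 𝕜 (fun y => edgeParameter (f y) a b) x := by
  unfold edgeParameter
  simp only [Ring.inverse_eq_inv']
  split_ifs
  · exact hf
  · exact (analyticAt_const.sub hf).inv h1
  · exact (hf.sub analyticAt_const).mul (hf.inv h0)

section Complex

theorem edgeParameter_im_pos {z : ℂ} (hz : 0 < z.im) (a b : Fin 4) :
    0 < (edgeParameter z a b).im := by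
  have inv_im_neg : ∀ {w : ℂ}, 0 < w.im → (w⁻¹).im < 0 := fun {w} hw => by
    rw [Complex.inv_im]
    exact div_neg_of_neg_of_pos (neg_lt_zero.2 hw)
      (Complex.normSq_pos.2 fun h => hw.ne' (h ▸ Complex.zero_im))
  unfold edgeParameter
  simp only [Ring.inverse_eq_inv']
  split_ifs
  · exact hz
  · have hw : 0 < (z - 1).im := by simpa only [Complex.sub_im, Complex.one_im, sub_zero] using hz
    rw [← neg_sub z 1, inv_neg, Complex.neg_im]
    exact neg_pos.2 (inv_im_neg hw)
  · have hz0 : z ≠ 0 := fun h => hz.ne' (h ▸ Complex.zero_im)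
    rw [sub_mul, mul_inv_cancel₀ hz0, one_mul, Complex.sub_im, Complex.one_im, zero_sub]
    exact neg_pos.2 (inv_im_neg hz)

theorem spacelike_of_ne_zero {z : ℂ} (hz : z ≠ 0) : Spacelike z :=
  ⟨Complex.normSq z, Complex.normSq_pos.2 hz, Complex.mul_conj z⟩

theorem spacelike_of_im_ne_zero {z : ℂ} (hz : z.im ≠ 0) : Spacelike z ∧ Spacelike (1 - z) := by
  refine ⟨spacelike_of_ne_zero fun h => hz ?_, spacelike_of_ne_zero fun h => hz ?_⟩
  · rw [h, Complex.zero_im]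
  · rw [← sub_eq_zero.1 h, Complex.one_im]

theorem tendsto_arg_of_im_pos {X : Type*} {l : Filter X} {w : X → ℂ} {x : ℝ} (hx : x ≠ 0)
    (hw : Tendsto w l (𝓝 (x : ℂ))) (him : ∀ᶠ s in l, 0 < (w s).im) :
    Tendsto (fun s => Complex.arg (w s)) l (𝓝 (realAngle x)) := by
  unfold realAngle
  split_ifs with h
  · exact (Complex.tendsto_arg_nhdsWithin_im_nonneg_of_re_neg_of_im_zero (z := (x : ℂ)) h
      (Complex.ofReal_im x)).comp (tendsto_nhdsWithin_iff.2 ⟨hw, him.mono fun _ hs => hs.le⟩)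
  · have hx' : 0 < x := lt_of_le_of_ne (not_lt.1 h) hx.symm
    rw [← Complex.arg_ofReal_of_nonneg hx'.le]
    exact (Complex.continuousAt_arg (Complex.ofReal_mem_slitPlane.2 hx')).tendsto.comp hw

theorem exp_sum_arg_mul_I {ι : Type*} {s : Finset ι} {w : ι → ℂ} (hprod : ∏ i ∈ s, w i = 1) :
    Complex.exp ((∑ i ∈ s, (w i).arg : ℝ) * Complex.I) = 1 := by
  have hnorm : ∏ i ∈ s, (‖w i‖ : ℂ) = 1 := by
    rw [← Complex.ofReal_prod, ← norm_prod, hprod, norm_one, Complex.ofReal_one]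
  calc Complex.exp ((∑ i ∈ s, (w i).arg : ℝ) * Complex.I)
      = ∏ i ∈ s, ‖w i‖ * Complex.exp ((w i).arg * Complex.I) := by
        rw [Finset.prod_mul_distrib, hnorm, one_mul, Complex.ofReal_sum, Finset.sum_mul,
          Complex.exp_sum]
    _ = 1 := by simp only [Complex.norm_mul_exp_arg_mul_I, hprod]

theorem sum_arg_eq_two_pi {ι : Type*} {s : Finset ι} {w : ι → ℂ} (hprod : ∏ i ∈ s, w i = 1)
    (hsum : |∑ i ∈ s, (w i).arg - 2 * Real.pi| < 2 * Real.pi) :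
    ∑ i ∈ s, (w i).arg = 2 * Real.pi := by
  obtain ⟨k, hk⟩ := Complex.exp_eq_one_iff.1 (exp_sum_arg_mul_I hprod)
  have hk' : ∑ i ∈ s, (w i).arg = k * (2 * Real.pi) := by
    simpa using congrArg Complex.im hk
  have hk1 : |(k - 1 : ℝ)| < 1 := by
    rw [hk', ← sub_one_mul, abs_mul, abs_of_pos Real.two_pi_pos] at hsum
    exact (mul_lt_iff_lt_one_left Real.two_pi_pos).1 hsum
  have hk0 : k - 1 = 0 := Int.abs_lt_one_iff.1 (by exact_mod_cast hk1)
  rw [hk', sub_eq_zero.1 hk0, Int.cast_one, one_mul]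

end Complex

namespace IdealTriangulation

variable {N : ℕ} {T : IdealTriangulation N}

theorem edgeProduct_ofReal {x : Fin N → ℝ} (hx : x ∈ T.realDeformationVariety)
    {e : Fin N × Equiv.Perm (Fin 4)} (he : Equiv.Perm.sign e.2 = 1) :
    T.edgeProduct (fun j => (x j : ℂ)) e = 1 := by
  obtain ⟨hspace, hedge⟩ := T.mem_thurstonSolutions_iff.1 hx
  have hmap := T.edgeProduct_map Complex.ofRealHom (fun j => (hspace j).1.isUnit)
    (fun j => (hspace j).2.isUnit) e
  rw [(hedge e he).1, map_one] at hmap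
  exact hmap.symm

theorem eventually_edgeProduct_eq_one {c : ℝ → Fin N → ℝ} {F : ℂ → Fin N → ℂ} {x : ℝ}
    (hF : AnalyticAt ℂ F x) (hFc : ∀ᶠ s : ℝ in 𝓝 x, F s = fun j => (c s j : ℂ))
    (hc : ∀ᶠ s in 𝓝 x, c s ∈ T.realDeformationVariety) {e : Fin N × Equiv.Perm (Fin 4)}
    (he : Equiv.Perm.sign e.2 = 1) : ∀ᶠ w in 𝓝 (x : ℂ), T.edgeProduct (F w) e = 1 := by
  have h0 : ∀ j, F x j ≠ 0 := fun j => by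
    rw [hFc.self_of_nhds]
    exact Complex.ofReal_ne_zero.2 (hc.self_of_nhds.1 j).1.isUnit.ne_zero
  have h1 : ∀ j, 1 - F x j ≠ 0 := fun j => by
    simp only [hFc.self_of_nhds]
    exact_mod_cast (hc.self_of_nhds.1 j).2.isUnit.ne_zero
  have hprod : AnalyticAt ℂ (fun w => T.edgeProduct (F w) e) x :=
    Finset.analyticAt_fun_prod _ fun i _ =>
      analyticAt_edgeParameter (analyticAt_pi_iff.1 hF _) (h0 _) (h1 _) _ _
  refine eventually_eq_of_eventually_ofReal hprod analyticAt_const ?_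
  filter_upwards [hFc, hc] with s hs hcs
  rw [hs, edgeProduct_ofReal hcs he]

theorem tendsto_edgeAngle_arg {X : Type*} {l : Filter X} {w : X → Fin N → ℂ} {z : Fin N → ℝ}
    (hz : ∀ j, IsUnit (z j) ∧ IsUnit (1 - z j)) (hw : Tendsto w l (𝓝 fun j => (z j : ℂ)))
    (him : ∀ᶠ s in l, ∀ j, 0 < (w s j).im) (e : Fin N × Equiv.Perm (Fin 4)) :
    Tendsto (fun s => T.edgeAngle Complex.arg (w s) e) l (𝓝 (T.edgeAngle realAngle z e)) := by
  refine tendsto_finsetSum _ fun i _ => tendsto_arg_of_im_pos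
    (isUnit_edgeParameter (hz _).1 (hz _).2 _ _).ne_zero ?_
    (him.mono fun s hs => edgeParameter_im_pos (hs _) _ _)
  rw [← Complex.ofRealHom_eq_coe, edgeParameter_map _ (hz _).1 (hz _).2]
  have h0 : ((z (T.around e i).1 : ℝ) : ℂ) ≠ 0 := Complex.ofReal_ne_zero.2 (hz _).1.ne_zero
  have h1 : (1 : ℂ) - (z (T.around e i).1 : ℝ) ≠ 0 := by exact_mod_cast (hz _).2.ne_zero
  exact (analyticAt_edgeParameter analyticAt_id h0 h1 _ _).continuousAt.tendsto.comp
    (tendsto_pi_nhds.1 hw _)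

theorem eventually_mem_thurstonSolutions_arg {X : Type*} {l : Filter X} {w : X → Fin N → ℂ}
    {z : Fin N → ℝ} (hz : z ∈ T.realDeformationVariety)
    (hw : Tendsto w l (𝓝 fun j => (z j : ℂ))) (him : ∀ᶠ s in l, ∀ j, 0 < (w s j).im)
    (hprod : ∀ e : Fin N × Equiv.Perm (Fin 4), Equiv.Perm.sign e.2 = 1 →
      ∀ᶠ s in l, T.edgeProduct (w s) e = 1) :
    ∀ᶠ s in l, w s ∈ T.thurstonSolutions Complex.arg := by
  obtain ⟨hspace, hedge⟩ := T.mem_thurstonSolutions_iff.1 hz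
  have hangle : ∀ e : Fin N × Equiv.Perm (Fin 4), Equiv.Perm.sign e.2 = 1 →
      ∀ᶠ s in l, |T.edgeAngle Complex.arg (w s) e - 2 * Real.pi| < 2 * Real.pi := fun e he => by
    have hlim := T.tendsto_edgeAngle_arg
      (fun j => ⟨(hspace j).1.isUnit, (hspace j).2.isUnit⟩) hw him e
    rw [(hedge e he).2] at hlim
    exact hlim.eventually (Metric.ball_mem_nhds _ Real.two_pi_pos)
  have hall : ∀ᶠ s in l, ∀ e : Fin N × Equiv.Perm (Fin 4), Equiv.Perm.sign e.2 = 1 →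
      T.edgeProduct (w s) e = 1 ∧ T.edgeAngle Complex.arg (w s) e = 2 * Real.pi :=
    eventually_all.2 fun e => eventually_imp_distrib_left.2 fun he => by
      filter_upwards [hprod e he, hangle e he] with s hs hs'
      exact ⟨hs, sum_arg_eq_two_pi hs hs'⟩
  filter_upwards [him, hall] with s hs hs'
  exact T.mem_thurstonSolutions_iff.2 ⟨fun j => spacelike_of_im_ne_zero (hs j).ne', hs'⟩

theorem exists_complexified_curve {z v : Fin N → ℝ} {c : ℝ → Fin N → ℝ}
    (hc : AnalyticAt ℝ c 0) (hc0 : c 0 = z) (hcv : HasDerivAt c v 0)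
    (hcD : ∀ᶠ s in 𝓝 0, c s ∈ T.realDeformationVariety) :
    ∃ F : ℂ → Fin N → ℂ, AnalyticAt ℂ F 0 ∧ F 0 = (fun j => (z j : ℂ)) ∧
      HasDerivAt F (fun j => (v j : ℂ)) 0 ∧
      ∀ e : Fin N × Equiv.Perm (Fin 4), Equiv.Perm.sign e.2 = 1 →
        ∀ᶠ w in 𝓝 0, T.edgeProduct (F w) e = 1 := by
  obtain ⟨F, hF, hFc⟩ := exists_complexification_pi hc
  have hFv : HasDerivAt F (fun j => (v j : ℂ)) (0 : ℝ) :=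
    hasDerivAt_of_hasDerivAt_ofReal hF.differentiableAt <| HasDerivAt.congr_of_eventuallyEq
      (hasDerivAt_pi.2 fun j => (hasDerivAt_pi.1 hcv j).ofReal_comp) hFc
  have hF0 : F (0 : ℝ) = fun j => (z j : ℂ) := by rw [hFc.self_of_nhds, hc0]
  have hprod := fun e (he : Equiv.Perm.sign (Prod.snd e) = 1) =>
    T.eventually_edgeProduct_eq_one hF hFc hcD he
  rw [Complex.ofReal_zero] at hF hFv hF0 hprod
  exact ⟨F, hF, hF0, hFv, hprod⟩

theorem exists_complex_path {z v : Fin N → ℝ} (hpos : ∀ j, 0 < v j) {c : ℝ → Fin N → ℝ}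
    (hc : AnalyticAt ℝ c 0) (hc0 : c 0 = z) (hcv : HasDerivAt c v 0)
    (hcD : ∀ᶠ s in 𝓝 0, c s ∈ T.realDeformationVariety) :
    ∃ ζ : ℝ → Fin N → ℂ, ContDiff ℝ ∞ ζ ∧ (∀ j, ζ 0 j = z j) ∧
      (∀ j, HasDerivAt (fun t => ζ t j) (Complex.I * v j) 0) ∧
      ∀ t, 0 < t → ζ t ∈ T.thurstonSolutions Complex.arg ∧ ∀ j, 0 < (ζ t j).im := by
  obtain ⟨F, hF, hF0, hFv, hprod⟩ := exists_complexified_curve hc hc0 hcv hcD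
  have hI : HasDerivAt (fun s : ℝ => Complex.I * s) Complex.I 0 :=
    (Complex.ofRealCLM.hasDerivAt.const_mul Complex.I).congr_deriv (mul_one _)
  have hI0 : Complex.I * (0 : ℝ) = 0 := by rw [Complex.ofReal_zero, mul_zero]
  have hIlim : Tendsto (fun s : ℝ => Complex.I * s) (𝓝 0) (𝓝 0) := hI0 ▸ hI.continuousAt.tendsto
  have hΓ0 : F (Complex.I * (0 : ℝ)) = fun j => (z j : ℂ) := hI0 ▸ hF0
  have hΓv : HasDerivAt (fun s : ℝ => F (Complex.I * s)) (Complex.I • fun j => (v j : ℂ)) 0 :=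
    hFv.scomp_of_eq 0 hI hI0.symm
  have hΓ : ∀ᶠ s : ℝ in 𝓝 0, ContDiffAt ℝ ∞ (fun s : ℝ => F (Complex.I * s)) s := by
    filter_upwards [hIlim.eventually hF.eventually_analyticAt] with s hs
    exact (hs.restrictScalars (𝕜 := ℝ)).contDiffAt.comp s
      (contDiff_const.mul Complex.ofRealCLM.contDiff).contDiffAt
  have him : ∀ᶠ s : ℝ in 𝓝[>] 0, ∀ j, 0 < (F (Complex.I * s) j).im :=
    eventually_all.2 fun j => eventually_pos_of_hasDerivAt
      (Complex.imCLM.hasFDerivAt.comp_hasDerivAt 0 (hasDerivAt_pi.1 hΓv j))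
      (by simp only [hΓ0, Complex.ofReal_im]) (by simpa using hpos j)
  have hmem : ∀ᶠ s : ℝ in 𝓝[>] 0, F (Complex.I * s) ∈ T.thurstonSolutions Complex.arg :=
    eventually_mem_thurstonSolutions_arg (hc0 ▸ hcD.self_of_nhds)
      (hΓ0 ▸ hΓv.continuousAt.tendsto.mono_left nhdsWithin_le_nhds) him fun e he =>
        eventually_nhdsWithin_of_eventually_nhds (hIlim.eventually (hprod e he))
  obtain ⟨ζ, hζ, hζ0, hζ', hζP⟩ := exists_contDiff_curve
    (P := fun y => y ∈ T.thurstonSolutions Complex.arg ∧ ∀ j, 0 < (y j).im) hΓ hΓv (hmem.and him)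
  exact ⟨ζ, hζ, fun j => congrFun (hζ0.trans hΓ0) j, hasDerivAt_pi.1 hζ', hζP⟩

variable (T) in
/-- The foliation with shape parameters `z` whose tetrahedra are all in standard position. -/
def standardFoliation {z : Fin N → ℝ} (hz : z ∈ T.realDeformationVariety) :
    T.TransverselyHyperbolicFoliation where
  toRealization := T.standardRealization hz
  angle := standardRealization_totalAngle hz

variable (T) in
/-- The hyperbolic structure with shape parameters `z` whose tetrahedra are all in standard
position. -/
def standardHyperbolicStructure {z : Fin N → ℂ} (hz : z ∈ T.thurstonSolutions Complex.arg)
    (him : ∀ j, 0 < (z j).im) : T.HyperbolicStructure where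
  toRealization := T.standardRealization hz
  oriented j := positivelyOriented_standardVertex rfl rfl rfl rfl (him j)
  angle := standardRealization_totalAngle hz

variable (T) in
/-- The AdS structure with shape parameters `z` whose tetrahedra are all in standard position. -/
def standardAdSStructure {z : Fin N → PseudoComplex} (hz : z ∈ T.thurstonSolutions pseudoAngle)
    (him : ∀ j, 0 < (z j).im) : T.AdSStructure where
  toRealization := T.standardRealization hz
  oriented j := positivelyOriented_standardVertex rfl rfl rfl rfl (him j)
  angle := standardRealization_totalAngle hz

end IdealTriangulation

end

theorem proposition5p1 {N : ℕ} (T : IdealTriangulation N) (z v : Fin N → ℝ)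
    (hz : z ∈ T.realDeformationVariety)
    (hsmooth : IsSmoothPoint T.realDeformationVariety z)
    (hv : IsTangentVector T.realDeformationVariety z v) (hpos : ∀ j, 0 < v j) :
    (∃ F : T.TransverselyHyperbolicFoliation, F.HasShapes z) ∧
    (∃ (ζ : ℝ → Fin N → ℂ) (H : Set.Ioi (0 : ℝ) → T.HyperbolicStructure),
      ContDiff ℝ ∞ ζ ∧ (∀ j, ζ 0 j = z j) ∧
      (∀ j, HasDerivAt (fun t => ζ t j) (Complex.I * v j) 0) ∧
      (∀ t : Set.Ioi (0 : ℝ), ζ t ∈ T.thurstonSolutions Complex.arg ∧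
        (∀ j, 0 < (ζ t j).im) ∧ (H t).HasShapes (ζ t)) ∧
      ∀ F : T.TransverselyHyperbolicFoliation, F.HasShapes z →
        IdealTriangulation.CollapsesTo (fun t => (H t).toRealization) F) ∧
    (∃ (ξ : ℝ → Fin N → PseudoComplex) (A : Set.Ioi (0 : ℝ) → T.AdSStructure),
      ContDiff ℝ ∞ (fun t j => (ξ t j).re) ∧ ContDiff ℝ ∞ (fun t j => (ξ t j).im) ∧
      (∀ j, ξ 0 j = algebraMap ℝ PseudoComplex (z j)) ∧
      (∀ j, HasDerivAt (fun t => (ξ t j).re) 0 0 ∧ HasDerivAt (fun t => (ξ t j).im) (v j) 0) ∧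
      (∀ t : Set.Ioi (0 : ℝ), ξ t ∈ T.thurstonSolutions pseudoAngle ∧
        (∀ j, 0 < (ξ t j).im) ∧ (A t).HasShapes (ξ t)) ∧
      ∀ F : T.TransverselyHyperbolicFoliation, F.HasShapes z →
        IdealTriangulation.CollapsesTo (fun t => (A t).toRealization) F) := by
  obtain ⟨c, hc, hc0, hcv, hcD⟩ := hsmooth.exists_analytic_curve hv
  obtain ⟨ζ, hζ, hζ0, hζ', hζpos⟩ := IdealTriangulation.exists_complex_path hpos hc hc0 hcv hcD
  obtain ⟨ξ, hre, him, hξ0, hξ', hξpos⟩ :=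
    IdealTriangulation.exists_pseudoComplex_path hpos hc hc0 hcv hcD
  have hξ : Continuous ξ := continuous_pi fun j => PseudoComplex.continuous_iff.2
    ⟨(contDiff_pi.1 hre j).continuous, (contDiff_pi.1 him j).continuous⟩
  refine ⟨⟨T.standardFoliation hz, IdealTriangulation.standardRealization_hasShapes hz⟩,
    ⟨ζ, fun t => T.standardHyperbolicStructure (hζpos t t.2).1 (hζpos t t.2).2, hζ, hζ0, hζ',
      fun t => ⟨(hζpos t t.2).1, (hζpos t t.2).2,
        IdealTriangulation.standardRealization_hasShapes (hζpos t t.2).1⟩, fun F hF => ?_⟩,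
    ⟨ξ, fun t => T.standardAdSStructure (hξpos t t.2).1 (hξpos t t.2).2, hre, him, hξ0, hξ',
      fun t => ⟨(hξpos t t.2).1, (hξpos t t.2).2,
        IdealTriangulation.standardRealization_hasShapes (hξpos t t.2).1⟩, fun F hF => ?_⟩⟩
  · exact IdealTriangulation.collapsesTo_standardRealization hz.1 (fun t => (hζpos t t.2).1)
      ((hζ.continuous.tendsto' 0 _ (funext hζ0)).comp tendsto_comap) hF
  · exact IdealTriangulation.collapsesTo_standardRealization hz.1 (fun t => (hξpos t t.2).1)
      ((hξ.tendsto' 0 _ (funext hξ0)).comp tendsto_comap) hF
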